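/- Let $p$ be a prime, $k$ a field of characteristic $p$, $G$ a finite group and $\Omega$ a finite $G$-set, with permutation module $k\Omega$. A *component* of a module is an indecomposable direct summand of it. A *vertex* of a component $M$ of $k\Omega$ is a subgroup $Q\le G$ that is minimal subject to $M$ being isomorphic to a direct summand of $\mathrm{Ind}_Q^G(L)$ for some $kQ$-module $L$. For $X\subseteq\Omega$ let $S_X$ and $N_X$ be the pointwise and the setwise stabilizer of $X$ in $G$, let $M_X=N_X/S_X$, and let $Q_X$ be a Sylow $p$-subgroup of $S_X$. We call $X$ *closed* if $\mathrm{Fix}_\Omega(Q_X)=X$ (this does not depend on the choice of $Q_X$); in that case $N_G(Q_X)\le N_X$, so that both $M_X$ and $N_G(Q_X)/Q_X$ act on $X$, and $kX$ denotes the permutation module for either group. A component $M$ of $k\Omega$ *admits $X$ as a fixed point set* if $X=\mathrm{Fix}_\Omega(Q)$ for some vertex $Q$ of $M$, and $X$ is a *fixed point set* if some component of $k\Omega$ admits it. A bijection between isomorphism types of components of two modules is *multiplicity-preserving* if corresponding isomorphism types occur equally often in decompositions of the two modules into indecomposable summands (these numbers do not depend on the decompositions). **Theorem** (Broué's correspondence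 for closed sets). Let $X\subseteq\Omega$ be closed. 1. For every choice of $Q_X$, the projective components of the $kM_X$-module $kX$ are in bijective correspondence with the projective components of the $k(N_G(Q_X)/Q_X)$-module $kX$: the same subspaces of $kX$ are projective components for both groups, and this induces a multiplicity-preserving bijection of isomorphism types. 2. There is a multiplicity-preserving bijection between the isomorphism types of components of $k\Omega$ which admit $X$ as a fixed point set and the isomorphism types of projective components of the $kM_X$-module $kX$. 3. $X$ is a fixed point set if and only if the $kM_X$-module $kX$ has a projective component. -/

import Mathlib

open scoped Pointwise MonoidAlgebra

namespace PermMod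

/-! ### Components of modules, isomorphism types, multiplicities -/

section Modules

universe u v w

variable (A : Type u) [Ring A]

/-- A module is indecomposable if it is nonzero and is not the direct sum of two nonzero
submodules. -/
def IsIndecomposable (M : Type v) [AddCommGroup M] [Module A M] : Prop :=
  Nontrivial M ∧ ∀ U W : Submodule A M, IsCompl U W → U = ⊥ ∨ W = ⊥

/-- A component of `V` is an indecomposable direct summand of `V`. -/
def IsComponent {V : Type v} [AddCommGroup V] [Module A V] (W : Submodule A V) : Prop :=
  IsIndecomposable A W ∧ IsComplemented W

/-- The components of `V` which have the property `P`. -/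
abbrev Component (V : Type v) [AddCommGroup V] [Module A V] (P : Submodule A V → Prop) : Type v :=
  {W : Submodule A V // IsComponent A W ∧ P W}

/-- Isomorphism of components as `A`-modules. -/
instance componentSetoid (V : Type v) [AddCommGroup V] [Module A V] (P : Submodule A V → Prop) :
    Setoid (Component A V P) where
  r W W' := Nonempty (W.1 ≃ₗ[A] W'.1)
  iseqv :=
    { refl := fun _ => ⟨LinearEquiv.refl _ _⟩
      symm := fun ⟨e⟩ => ⟨e.symm⟩
      trans := fun ⟨e⟩ ⟨f⟩ => ⟨e.trans f⟩ }

/-- The isomorphism types of the components of `V` which have the property `P`. -/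
abbrev ComponentType (V : Type v) [AddCommGroup V] [Module A V] (P : Submodule A V → Prop) :
    Type v :=
  Quotient (componentSetoid A V P)

/-- `D` is a decomposition of `V` as a direct sum of finitely many indecomposable submodules. -/
def IsDecomposition {V : Type v} [AddCommGroup V] [Module A V] {n : ℕ}
    (D : Fin n → Submodule A V) : Prop :=
  DirectSum.IsInternal D ∧ ∀ i, IsIndecomposable A (D i)

/-- The number `m` is the multiplicity of `M` as a component of `V`: the module `V` has a
decomposition into indecomposable submodules, and in every such decomposition exactly `m` of the
summands are isomorphic to `M`. -/
def HasMultiplicity (V : Type v) [AddCommGroup V] [Module A V] (M : Type w) [AddCommGroup M]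
    [Module A M] (m : ℕ) : Prop :=
  (∃ (n : ℕ) (D : Fin n → Submodule A V), IsDecomposition A D) ∧
    ∀ (n : ℕ) (D : Fin n → Submodule A V), IsDecomposition A D →
      Nat.card {i : Fin n // Nonempty (D i ≃ₗ[A] M)} = m

end Modules

/-- A bijection between isomorphism types of components is multiplicity-preserving if
corresponding components occur with the same multiplicity. -/
def MultiplicityPreserving {A B V W : Type*} [Ring A] [Ring B] [AddCommGroup V] [Module A V]
    [AddCommGroup W] [Module B W] {P : Submodule A V → Prop} {R : Submodule B W → Prop}
    (Φ : ComponentType A V P ≃ ComponentType B W R) : Prop :=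
  ∀ (U : Component A V P) (U' : Component B W R),
    Φ (Quotient.mk _ U) = Quotient.mk _ U' →
      ∃ m : ℕ, HasMultiplicity A V U.1 m ∧ HasMultiplicity B W U'.1 m

/-! ### Vertices -/

section Vertex

universe v

variable (k : Type*) {G : Type*} [Field k] [Group G]

/-- There is a `kH`-module `L` such that `M` is isomorphic to a direct summand of `Ind_H^G L`. -/
def IsRelativelyProjective (M : Type v) [AddCommGroup M] [Module k[G] M] (H : Subgroup G) : Prop :=
  ∃ (L : Type v) (_ : AddCommGroup L) (_ : Module k L) (σ : Representation k H L)
    (i : M →ₗ[k[G]] (Representation.ind H.subtype σ).asModule)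
    (q : (Representation.ind H.subtype σ).asModule →ₗ[k[G]] M), q ∘ₗ i = LinearMap.id

/-- A vertex of `M` is a subgroup `Q` of `G` which is minimal subject to `M` being a direct
summand of a module induced from `Q`. -/
def IsVertex (M : Type v) [AddCommGroup M] [Module k[G] M] (Q : Subgroup G) : Prop :=
  Minimal (IsRelativelyProjective k M) Q

end Vertex

/-! ### Subsets of a `G`-set -/

section GSet

variable (k : Type*) [Field k] (p : ℕ) (G : Type*) [Group G] {Ω : Type*} [MulAction G Ω]

/-- The component `W` of `kΩ` admits `X` as a fixed point set: it has a vertex `Q` such that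
`X = Fix_Ω(Q)`. -/
def AdmitsFixedPointSet (X : Set Ω)
    (W : Submodule k[G] (Representation.ofMulAction k G Ω).asModule) : Prop :=
  ∃ Q : Subgroup G, IsVertex k W Q ∧ MulAction.fixedPoints Q Ω = X

/-- `X` is a fixed point set if it is `Fix_Ω(Q)` for a vertex `Q` of a component of `kΩ`. -/
def IsFixedPointSet (X : Set Ω) : Prop :=
  ∃ W : Submodule k[G] (Representation.ofMulAction k G Ω).asModule,
    IsComponent k[G] W ∧ AdmitsFixedPointSet k G X W

/-- The pointwise stabilizer `S_X`. -/
abbrev pointStab (X : Set Ω) : Subgroup G := fixingSubgroup G X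

/-- The set stabilizer `N_X`. -/
abbrev setStab (X : Set Ω) : Subgroup G := MulAction.stabilizer G X

variable {p G}

/-- A Sylow `p`-subgroup `Q_X` of `S_X`, as a subgroup of `G`. -/
abbrev sylowSub {X : Set Ω} (Q : Sylow p (pointStab G X)) : Subgroup G :=
  (Q : Subgroup (pointStab G X)).map (pointStab G X).subtype

variable (p G)

/-- `X` is closed if `Fix_Ω(Q_X) = X` for a Sylow `p`-subgroup `Q_X` of `S_X`; it does not matter
for which one, see `IsClosedSet.fixedPoints_eq`. -/
def IsClosedSet (X : Set Ω) : Prop :=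
  ∃ Q : Sylow p (pointStab G X), MulAction.fixedPoints (sylowSub Q) Ω = X

variable {p G}

theorem mem_fixedPoints_sylowSub {X : Set Ω} (Q : Sylow p (pointStab G X)) (ω : Ω) :
    ω ∈ MulAction.fixedPoints (sylowSub Q) Ω ↔ ∀ s ∈ Q, (s : G) • ω = ω := by
  constructor
  · intro h s hs
    exact h ⟨s, Subgroup.mem_map_of_mem _ hs⟩
  · rintro h ⟨g, hg⟩
    obtain ⟨s, hs, rfl⟩ := Subgroup.mem_map.1 hg
    exact h s hs

theorem IsClosedSet.fixedPoints_eq [Fact p.Prime] [Finite G] {X : Set Ω} (hX : IsClosedSet p G X)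
    (Q : Sylow p (pointStab G X)) : MulAction.fixedPoints (sylowSub Q) Ω = X := by
  obtain ⟨R, hR⟩ := hX
  apply Set.Subset.antisymm
  · intro ω hω
    rw [mem_fixedPoints_sylowSub] at hω
    obtain ⟨t, rfl⟩ := MulAction.exists_smul_eq (pointStab G X) R Q
    have key : (t⁻¹ : G) • ω ∈ X := by
      apply hR.subset
      rw [mem_fixedPoints_sylowSub]
      intro s hs
      have := hω (t * s * t⁻¹) (by
        rw [Sylow.smul_def]
        exact Subgroup.smul_mem_pointwise_smul s (MulAut.conj t) _ hs)
      rw [eq_inv_smul_iff, smul_smul, smul_smul]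
      simpa [mul_assoc] using this
    have h2 := (mem_fixingSubgroup_iff G).1 t.2 _ key
    rw [smul_inv_smul] at h2
    rwa [h2]
  · intro x hx
    rw [mem_fixedPoints_sylowSub]
    intro s _
    exact (mem_fixingSubgroup_iff G).1 s.2 x hx

theorem pointStab_le_setStab (X : Set Ω) : pointStab G X ≤ setStab G X := by
  intro g hg
  rw [MulAction.mem_stabilizer_set]
  intro x
  rw [mem_fixingSubgroup_iff] at hg
  constructor
  · intro h
    have := hg _ h
    rwa [← MulAction.injective g this]
  · intro h
    rwa [hg x h]

instance pointStab_normal (X : Set Ω) : ((pointStab G X).subgroupOf (setStab G X)).Normal := by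
  refine ⟨fun s hs g => ?_⟩
  rw [Subgroup.mem_subgroupOf, mem_fixingSubgroup_iff] at hs ⊢
  intro x hx
  have h1 : (g : G)⁻¹ • x ∈ X := by
    have := (MulAction.mem_stabilizer_set.1 (inv_mem g.2) x).2 hx
    exact this
  have h2 := hs _ h1
  have h3 : ((g * s * g⁻¹ : setStab G X) : G) • x = (g : G) • (s : G) • (g : G)⁻¹ • x := by
    simp [mul_smul]
  rw [h3, h2, smul_inv_smul]

theorem sylowSub_le_pointStab {X : Set Ω} (Q : Sylow p (pointStab G X)) :
    sylowSub Q ≤ pointStab G X :=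
  Subgroup.map_subtype_le _

/-- The normalizer `N_G(Q_X)`. -/
abbrev sylowNormalizer {X : Set Ω} (Q : Sylow p (pointStab G X)) : Subgroup G :=
  Subgroup.normalizer (sylowSub Q : Set G)

/-- The inclusion `N_G(Q_X) ≤ N_X` for a closed set, needed to let `N_G(Q_X)` act on `X`. -/
theorem IsClosedSet.normalizer_le [Fact p.Prime] [Finite G] {X : Set Ω} (hX : IsClosedSet p G X)
    (Q : Sylow p (pointStab G X)) : sylowNormalizer Q ≤ setStab G X := by
  have key : ∀ g ∈ sylowNormalizer Q, ∀ x ∈ X, g • x ∈ X := by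
    intro g hg x hx
    rw [← hX.fixedPoints_eq Q] at hx ⊢
    rintro ⟨s, hs⟩
    have h1 : g⁻¹ * s * g ∈ sylowSub Q := by
      have := (Subgroup.mem_normalizer_iff.1 (inv_mem hg) s).1 hs
      simpa using this
    have h2 : (g⁻¹ * s * g) • x = x := hx ⟨_, h1⟩
    change s • g • x = g • x
    rw [mul_smul, mul_smul, inv_smul_eq_iff] at h2
    exact h2
  intro g hg
  rw [MulAction.mem_stabilizer_set]
  intro x
  refine ⟨fun h => ?_, key g hg x⟩
  have := key _ (inv_mem hg) _ h
  rwa [inv_smul_smul] at this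

/-- Let `K` be a normal subgroup of `H`, where `H` leaves `X` invariant and `K` fixes `X`
pointwise. This is the permutation action of `H / K` on `X`. -/
def sectionPerm (X : Set Ω) (H K : Subgroup G) [(K.subgroupOf H).Normal]
    (hH : H ≤ setStab G X) (hK : K ≤ pointStab G X) :
    H ⧸ K.subgroupOf H →* Equiv.Perm X :=
  QuotientGroup.lift (K.subgroupOf H)
    ((MulAction.toPermHom (setStab G X) X).comp (Subgroup.inclusion hH))
    (by
      intro h hh
      ext x
      exact (mem_fixingSubgroup_iff G).1 (hK (Subgroup.mem_subgroupOf.1 hh)) x x.2)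

theorem sectionPerm_mk (X : Set Ω) (H K : Subgroup G) [(K.subgroupOf H).Normal]
    (hH : H ≤ setStab G X) (hK : K ≤ pointStab G X) (h : H) (x : X) :
    ((sectionPerm X H K hH hK (QuotientGroup.mk h) x : X) : Ω) = (h : G) • (x : Ω) := rfl

/-- The permutation `k(H/K)`-module `kX`. -/
noncomputable def sectionRep (X : Set Ω) (H K : Subgroup G) [(K.subgroupOf H).Normal]
    (hH : H ≤ setStab G X) (hK : K ≤ pointStab G X) :
    Representation k (H ⧸ K.subgroupOf H) k[X] :=
  (Representation.ofMulAction k (Equiv.Perm X) X).comp (sectionPerm X H K hH hK)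

variable (G) in
/-- The group `M_X = N_X / S_X`. -/
abbrev MX (X : Set Ω) : Type _ := setStab G X ⧸ (pointStab G X).subgroupOf (setStab G X)

variable (G) in
/-- The permutation `kM_X`-module `kX`. -/
noncomputable abbrev repMX (X : Set Ω) : Representation k (MX G X) k[X] :=
  sectionRep k X (setStab G X) (pointStab G X) le_rfl le_rfl

/-- The group `N_G(Q_X) / Q_X`. -/
abbrev NQ {X : Set Ω} (Q : Sylow p (pointStab G X)) : Type _ :=
  sylowNormalizer Q ⧸ (sylowSub Q).subgroupOf (sylowNormalizer Q)

/-- The permutation `k(N_G(Q_X)/Q_X)`-module `kX` for a closed set `X`. -/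
noncomputable abbrev repNQ [Fact p.Prime] [Finite G] {X : Set Ω} (hX : IsClosedSet p G X)
    (Q : Sylow p (pointStab G X)) : Representation k (NQ Q) k[X] :=
  sectionRep k X (sylowNormalizer Q) (sylowSub Q) (hX.normalizer_le Q) (sylowSub_le_pointStab Q)

/-- The components of the module of a representation that are projective. -/
abbrev ProjComponent {k Γ V : Type*} [Field k] [Group Γ] [AddCommGroup V] [Module k V]
    (ρ : Representation k Γ V) : Type _ :=
  Component k[Γ] ρ.asModule (fun W => Module.Projective k[Γ] W)

/-- The isomorphism types of the projective components of the module of a representation. -/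
abbrev ProjComponentType {k Γ V : Type*} [Field k] [Group Γ] [AddCommGroup V] [Module k V]
    (ρ : Representation k Γ V) : Type _ :=
  ComponentType k[Γ] ρ.asModule (fun W => Module.Projective k[Γ] W)

end GSet

end PermMod

/-! Components of a module V correspond to primitive idempotents of E = End(V), and isomorphic
components to equivalent idempotents (`isIndecomposable_range_iff`, `nonempty_equiv_range_iff`). The
argument therefore takes place in finite-dimensional algebras, where eEe is local for primitive e.
By Higman's criterion (`projective_iff_exists_trace`, `isRelativelyProjective_iff_exists_trace`) a
component is projective, or projective relative to H, exactly when its idempotent is a trace from 1,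
or from H.

Endomorphisms of permutation modules are invariant matrices. Restricting a matrix to the rows and
columns in X is an algebra homomorphism φ from End(kΩ) over kG to End(kX) over kM_X, because the
Q_X-orbits outside X contribute multiples of p to each entry of a product (`compress_mul`,
`exists_brauerHom`). Let J be the ideal of traces from Q_X. A component admits X exactly when its
idempotent lies in J and is not killed by φ (`admitsFixedPointSet_range_iff`). The image φ(J) is the
whole ideal of traces from the trivial subgroup of M_X (`compress_relTrace_eq_sum`,
`exists_compress_eq`), so its primitive idempotents are those of the projective components of kX.

The map φ need not be surjective, but φ(J) is an ideal of the target. With locality of eEe this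
suffices to lift primitive idempotents and their equivalences from φ(J) to J
(`IsLiftable.exists_multiplicityPreserving`). Multiplicities need no separate Krull–Schmidt theorem:
if S is the simple quotient of E belonging to e, then e occurs dim S / dim eS times in every
decomposition (`card_idemEquiv_mul`), and φ identifies the simple modules of e and φ(e).

The passage between N_G(Q_X)/Q_X and M_X rests on a surjection (Frattini) whose kernel has order
prime to p. Both groups then have the same endomorphisms of kX and the same ideal of traces from 1,
which gives the first claim and also enters the computation of φ(J). -/

namespace PermMod

/-! ### Primitive idempotents of finite-dimensional algebras -/

section Idempotents

variable {k E E' : Type*} [Field k] [Ring E] [Algebra k E] [Ring E'] [Algebra k E']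

/-- A primitive idempotent of a ring. -/
structure IsPrimIdem (e : E) : Prop where
  idem : e * e = e
  ne_zero : e ≠ 0
  eq_zero_or_eq : ∀ c, c * c = c → e * c = c → c * e = c → c = 0 ∨ c = e

/-- Equivalence of idempotents (Murray-von Neumann equivalence). -/
def IdemEquiv (e f : E) : Prop := ∃ a b, a * b = e ∧ b * a = f

theorem IdemEquiv.symm {e f : E} (h : IdemEquiv e f) : IdemEquiv f e := by
  obtain ⟨a, b, h1, h2⟩ := h
  exact ⟨b, a, h2, h1⟩

theorem IdemEquiv.map {e f : E} (h : IdemEquiv e f) (φ : E →+* E') :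
    IdemEquiv (φ e) (φ f) := by
  obtain ⟨a, b, rfl, rfl⟩ := h
  exact ⟨φ a, φ b, by simp, by simp⟩

-- Fitting's lemma inside the algebra. The commutative subalgebra generated by a is Artinian, so the
-- ideals generated by the powers of a stabilize; the idempotent found acts as the identity on a
-- high power of a.
variable (k) in
theorem exists_idempotent_pow_mul [FiniteDimensional k E] (a : E) :
    ∃ (m : ℕ) (z : E), Commute a z ∧
      a ^ (m + 1) * z * (a ^ (m + 1) * z) = a ^ (m + 1) * z ∧
      a ^ (m + 1) * (a ^ (m + 1) * z) = a ^ (m + 1) := by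
  let S := Algebra.adjoin k {a}
  have : IsMulCommutative S := Algebra.isMulCommutative_adjoin k (by simp)
  have : IsArtinianRing S := IsArtinianRing.of_finite k S
  obtain ⟨n, y, hy⟩ := IsArtinian.exists_pow_succ_smul_dvd
    (⟨a, Algebra.self_mem_adjoin_singleton k a⟩ : S) (1 : S)
  have hy' : a ^ (n + 1) * (y : E) = a ^ n := by
    have := congrArg (Subtype.val) hy
    simpa using this
  have hc : Commute a (y : E) := by
    have := mul_comm (⟨a, Algebra.self_mem_adjoin_singleton k a⟩ : S) y
    exact congrArg Subtype.val this
  have h1 : ∀ j, a ^ (n + j) * (y : E) ^ j = a ^ n := by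
    intro j
    induction j with
    | zero => simp
    | succ j ih =>
      calc a ^ (n + (j + 1)) * (y : E) ^ (j + 1)
          = a ^ j * (a ^ (n + 1) * y) * (y : E) ^ j := by
            rw [pow_succ' (y : E)]
            simp only [← mul_assoc, ← pow_add]
            congr 3
            omega
        _ = a ^ (n + j) * (y : E) ^ j := by rw [hy', ← pow_add, add_comm]
        _ = a ^ n := ih
  have h2 : a ^ (n + 1) * (a ^ (n + 1) * (y : E) ^ (n + 1)) = a ^ (n + 1) := by
    rw [← mul_assoc, ← pow_add, show n + 1 + (n + 1) = 1 + (n + (n + 1)) by omega, pow_add a 1,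
      mul_assoc, h1, pow_one, ← pow_succ']
  refine ⟨n, (y : E) ^ (n + 1), hc.pow_right _, ?_, h2⟩
  have hc2 : Commute (a ^ (n + 1)) ((y : E) ^ (n + 1)) := hc.pow_pow _ _
  calc a ^ (n + 1) * (y : E) ^ (n + 1) * (a ^ (n + 1) * (y : E) ^ (n + 1))
      = a ^ (n + 1) * (a ^ (n + 1) * (y : E) ^ (n + 1)) * (y : E) ^ (n + 1) := by
        simp only [mul_assoc]
        rw [← mul_assoc ((y : E) ^ (n + 1)), ← hc2.eq, mul_assoc]
    _ = _ := by rw [h2]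

/-- The corner eEe is local: the Fitting idempotent of a lies in it, hence is 0 or e. -/
theorem IsPrimIdem.pow_eq_zero_or_inv (k : Type*) [Field k] [Algebra k E] [FiniteDimensional k E]
    {e : E} (he : IsPrimIdem e) {a : E} (h1 : e * a = a) (h2 : a * e = a) :
    (∃ m, a ^ (m + 1) = 0) ∨ ∃ c, c * a = e ∧ a * c = e := by
  obtain ⟨m, z, hc, hu, ha⟩ := exists_idempotent_pow_mul k a
  have hc2 : Commute (a ^ (m + 1)) z := hc.pow_left _
  have e1 : e * (a ^ (m + 1) * z) = a ^ (m + 1) * z := by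
    rw [pow_succ', ← mul_assoc, ← mul_assoc, h1]
  have e2 : (a ^ (m + 1) * z) * e = a ^ (m + 1) * z := by
    rw [hc2.eq, mul_assoc, pow_succ, mul_assoc, h2]
  rcases he.eq_zero_or_eq _ hu e1 e2 with h | h
  · left
    exact ⟨m, by rw [← ha, h, mul_zero]⟩
  · right
    refine ⟨a ^ m * z, ?_, ?_⟩
    · rw [mul_assoc, ← hc.eq, ← mul_assoc, ← pow_succ, h]
    · rw [← mul_assoc, ← pow_succ', h]

/-- The elements `a` for which right multiplication by `a * e` is not split on `e`. For a primitive
idempotent `e` this is the largest left ideal that does not contain `e`, up to `E * (1 - e)`. -/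
def nonSplit (k : Type*) [Field k] [Algebra k E] [FiniteDimensional k E] {e : E}
    (he : IsPrimIdem e) : Submodule E E where
  carrier := {a | ∀ b, e * b * a * e ≠ e}
  zero_mem' b := by simpa using he.ne_zero.symm
  smul_mem' c a ha b := by simpa [mul_assoc] using ha (b * c)
  add_mem' {a a'} ha ha' b h := by
    have hx1 : e * (e * b * a * e) = e * b * a * e := by simp only [← mul_assoc, he.idem]
    have hx2 : (e * b * a * e) * e = e * b * a * e := by simp only [mul_assoc, he.idem]
    -- With x = ebae and y = eba'e one has x + y = e. Either x is nilpotent, and then y = (1 - x)e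
    -- is left-cancelled by an inverse of 1 - x, or x is invertible in eEe; one of the summands is
    -- thus split.
    rcases he.pow_eq_zero_or_inv k hx1 hx2 with ⟨m, hm⟩ | ⟨c, hc, -⟩
    · have hn : IsNilpotent (e * b * a * e) := ⟨_, hm⟩
      obtain ⟨t, ht⟩ := hn.isUnit_one_sub.exists_left_inv
      have hy : e * b * a' * e = (1 - e * b * a * e) * e := by
        rw [sub_mul, hx2, one_mul, eq_sub_iff_add_eq]
        rw [mul_add, add_mul] at h
        rw [add_comm, h]
      apply ha' (t * e * b)
      calc e * (t * e * b) * a' * e = e * (t * (e * b * a' * e)) := by simp only [mul_assoc]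
        _ = e := by rw [hy, ← mul_assoc t, ht, one_mul, he.idem]
    · apply ha (c * e * b)
      calc e * (c * e * b) * a * e = e * (c * (e * b * a * e)) := by simp only [mul_assoc]
        _ = e := by rw [hc, he.idem]

/-- The dimension of `g S` for an idempotent `g` and a module `S`. -/
noncomputable def idemRank (k : Type*) [Field k] [Algebra k E] (S : Type*) [AddCommGroup S]
    [Module E S] [Module k S] [IsScalarTower k E S] (g : E) : ℕ :=
  Module.finrank k (LinearMap.range (Algebra.lsmul k k S g))

section

variable {S : Type*} [AddCommGroup S] [Module E S] [Module k S] [IsScalarTower k E S]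

theorem idemRank_le_of_equiv [FiniteDimensional k S] {e f : E} (he : e * e = e)
    (h : IdemEquiv e f) : idemRank k S e ≤ idemRank k S f := by
  obtain ⟨a, b, h1, h2⟩ := h
  have key : ∀ s ∈ LinearMap.range (Algebra.lsmul k k S e), e • s = s := by
    rintro _ ⟨t, rfl⟩
    simp [smul_smul, he]
  refine LinearMap.finrank_le_finrank_of_injective
    (f := LinearMap.restrict (Algebra.lsmul k k S b) (fun s hs => ⟨b • s, ?_⟩)) ?_
  · change f • b • s = b • s
    conv_rhs => rw [← key s hs, ← h1]
    simp only [smul_smul, ← h2, mul_assoc]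
  · intro s t hst
    have h3 : b • (s : S) = b • (t : S) := congrArg Subtype.val hst
    apply Subtype.ext
    calc (s : S) = a • b • (s : S) := by rw [smul_smul, h1, key s s.2]
      _ = (t : S) := by rw [h3, smul_smul, h1, key t t.2]

theorem idemRank_eq_of_equiv [FiniteDimensional k S] {e f : E} (he : e * e = e) (hf : f * f = f)
    (h : IdemEquiv e f) : idemRank k S e = idemRank k S f :=
  le_antisymm (idemRank_le_of_equiv he h) (idemRank_le_of_equiv hf h.symm)

theorem idemRank_eq_zero_of_smul {e : E} (h : ∀ s : S, e • s = 0) : idemRank k S e = 0 := by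
  have : LinearMap.range (Algebra.lsmul k k S e) = ⊥ :=
    LinearMap.range_eq_bot.2 (LinearMap.ext h)
  rw [idemRank, this, finrank_bot]

theorem idemRank_pos_of_smul [FiniteDimensional k S] {e : E} {s : S} (h : e • s ≠ 0) :
    0 < idemRank k S e := by
  have : Nontrivial (LinearMap.range (Algebra.lsmul k k S e)) :=
    ⟨⟨⟨_, s, rfl⟩, 0, fun h' => h (congrArg Subtype.val h')⟩⟩
  exact Module.finrank_pos

/-- The Peirce decomposition of S as the direct sum of the spaces e_i S. -/
theorem finrank_eq_sum_idemRank [FiniteDimensional k S] {ι : Type*} [Fintype ι] {e : ι → E}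
    (he : CompleteOrthogonalIdempotents e) :
    Module.finrank k S = ∑ i, idemRank k S (e i) := by
  classical
  let F : S →ₗ[k] Π i, LinearMap.range (Algebra.lsmul k k S (e i)) :=
    LinearMap.pi fun i => (Algebra.lsmul k k S (e i)).rangeRestrict
  have hF : Function.Bijective F := by
    constructor
    · intro s t hst
      have : ∀ i, e i • s = e i • t := fun i => congrArg Subtype.val (congrFun hst i)
      rw [← one_smul E s, ← one_smul E t, ← he.complete, Finset.sum_smul, Finset.sum_smul]
      simp [this]
    · intro w
      refine ⟨∑ i, (w i : S), funext fun i => Subtype.ext ?_⟩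
      change e i • ∑ j, (w j : S) = w i
      rw [Finset.smul_sum, Finset.sum_eq_single i]
      · obtain ⟨t, ht⟩ := (w i).2
        rw [← ht]
        simp [smul_smul, (he.idem i).eq]
      · intro j _ hj
        obtain ⟨t, ht⟩ := (w j).2
        rw [← ht]
        simp [smul_smul, he.ortho hj.symm]
      · simp
  rw [(LinearEquiv.ofBijective F hF).finrank_eq, Module.finrank_pi_fintype]
  rfl

end

section

variable [FiniteDimensional k E]

theorem mem_nonSplit {e : E} (he : IsPrimIdem e) {a : E} :
    a ∈ nonSplit k he ↔ ∀ b, e * b * a * e ≠ e := Iff.rfl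

theorem self_notMem_nonSplit {e : E} (he : IsPrimIdem e) : e ∉ nonSplit k he := fun h =>
  h 1 (by simp [he.idem])

/-- A form of Rosenberg's lemma: `nonSplit` is closed under sums and misses e. It serves to put a
primitive idempotent that is a sum of elements of several ideals into one of them. -/
theorem IsPrimIdem.exists_of_sum_eq (k : Type*) [Field k] [Algebra k E] [FiniteDimensional k E]
    {ι : Type*} {e : E} (he : IsPrimIdem e) (s : Finset ι) (a : ι → E)
    (h : ∑ i ∈ s, a i = e) : ∃ i ∈ s, ∃ b, e * b * a i * e = e := by
  by_contra! hcon
  apply self_notMem_nonSplit (k := k) he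
  have hs := sum_mem fun i hi => (mem_nonSplit (k := k) he).2 (hcon i hi)
  rwa [h] at hs

/-- If f does not annihilate the quotient, there are x in eEf and y in fEe with xy = e. Then yx is a
nonzero idempotent of fEf, so it equals f, and e and f are equivalent. -/
theorem idemRank_eq_zero {e f : E} (he : IsPrimIdem e) (hf : IsPrimIdem f)
    (h : ¬ IdemEquiv f e) : idemRank k (E ⧸ nonSplit k he) f = 0 := by
  apply idemRank_eq_zero_of_smul
  intro s
  obtain ⟨a, rfl⟩ := Submodule.Quotient.mk_surjective _ s
  rw [← Submodule.Quotient.mk_smul, Submodule.Quotient.mk_eq_zero, mem_nonSplit]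
  intro b hb
  rw [smul_eq_mul] at hb
  have hff : ∀ x, f * (f * x) = f * x := fun x => by rw [← mul_assoc, hf.idem]
  have hee : ∀ x, e * (e * x) = e * x := fun x => by rw [← mul_assoc, he.idem]
  have hxy : (e * b * f) * (f * a * e) = e := by
    calc (e * b * f) * (f * a * e) = e * b * (f * a) * e := by simp only [mul_assoc, hff]
      _ = e := hb
  have hyx : (f * a * e) * (e * b * f) * ((f * a * e) * (e * b * f)) =
      (f * a * e) * (e * b * f) := by
    calc _ = (f * a * e) * ((e * b * f) * (f * a * e)) * (e * b * f) := by simp only [mul_assoc]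
      _ = _ := by rw [hxy]; simp only [mul_assoc, hee]
  rcases hf.eq_zero_or_eq _ hyx (by simp only [mul_assoc, hff])
    (by simp only [mul_assoc, hf.idem]) with h0 | h1
  · apply he.ne_zero
    calc e = (e * b * f) * (f * a * e) * ((e * b * f) * (f * a * e)) := by rw [hxy, he.idem]
      _ = (e * b * f) * ((f * a * e) * (e * b * f)) * (f * a * e) := by simp only [mul_assoc]
      _ = 0 := by rw [h0]; simp
  · exact h ⟨_, _, h1, hxy⟩

theorem idemRank_self_pos {e : E} (he : IsPrimIdem e) :
    0 < idemRank k (E ⧸ nonSplit k he) e := by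
  apply idemRank_pos_of_smul (s := Submodule.Quotient.mk 1)
  rw [← Submodule.Quotient.mk_smul, Ne, Submodule.Quotient.mk_eq_zero, smul_eq_mul, mul_one]
  exact self_notMem_nonSplit he

/-- In the Peirce decomposition of the simple quotient only the idempotents equivalent to e
contribute, all equally. Nothing but the counted number depends on the decomposition, so that number
does not depend on it either. -/
theorem card_idemEquiv_mul {ι : Type*} [Fintype ι] {e : E} (he : IsPrimIdem e) {g : ι → E}
    (hg : CompleteOrthogonalIdempotents g) (hg' : ∀ i, IsPrimIdem (g i)) :
    Nat.card {i // IdemEquiv (g i) e} * idemRank k (E ⧸ nonSplit k he) e =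
      Module.finrank k (E ⧸ nonSplit k he) := by
  classical
  rw [finrank_eq_sum_idemRank hg, Nat.card_eq_fintype_card, Fintype.card_subtype,
    ← smul_eq_mul, ← Finset.sum_const, Finset.sum_filter]
  refine Finset.sum_congr rfl fun i _ => ?_
  split_ifs with h
  · exact (idemRank_eq_of_equiv (hg.idem i) he.idem h).symm
  · exact (idemRank_eq_zero he (hg' i) h).symm

end

/-! ### Lifting of idempotents from an ideal -/

/-- The set `J` is closed under multiplication with elements of `E`, and its image under `φ` is
closed under multiplication with elements of `E'`. -/
structure IsLiftable (φ : E →ₐ[k] E') (J : Set E) : Prop where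
  mul_left : ∀ c, ∀ j ∈ J, c * j ∈ J
  mul_right : ∀ j ∈ J, ∀ c, j * c ∈ J
  lift_left : ∀ c, ∀ j ∈ J, ∃ j' ∈ J, φ j' = c * φ j
  lift_right : ∀ j ∈ J, ∀ c, ∃ j' ∈ J, φ j' = φ j * c

variable [FiniteDimensional k E] {φ : E →ₐ[k] E'} {J : Set E}

theorem eq_zero_of_idem_of_pow_eq_zero {R : Type*} [Ring R] {c : R} (hc : c * c = c) {m : ℕ}
    (h : c ^ (m + 1) = 0) : c = 0 := by
  rwa [(show IsIdempotentElem c from hc).pow_succ_eq m] at h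

/-- An idempotent c below φ(e) equals cφ(e), hence has a preimage, which may be taken in the local
ring eEe. A nilpotent preimage forces c = 0, an invertible one forces c = φ(e). -/
theorem IsLiftable.isPrimIdem (hJ : IsLiftable φ J) {e : E} (he : IsPrimIdem e) (heJ : e ∈ J)
    (h0 : φ e ≠ 0) : IsPrimIdem (φ e) := by
  refine ⟨by rw [← map_mul, he.idem], h0, fun c hc h1 h2 => ?_⟩
  obtain ⟨j, -, hj⟩ := hJ.lift_left c e heJ
  rw [h2] at hj
  have ha : φ (e * j * e) = c := by rw [map_mul, map_mul, hj, h1, h2]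
  rcases he.pow_eq_zero_or_inv k (a := e * j * e) (by simp only [← mul_assoc, he.idem])
    (by simp only [mul_assoc, he.idem]) with ⟨m, hm⟩ | ⟨d, hd, -⟩
  · left
    apply eq_zero_of_idem_of_pow_eq_zero hc (m := m)
    rw [← ha, ← map_pow, hm, map_zero]
  · right
    have h3 : φ d * c = φ e := by rw [← ha, ← map_mul, hd]
    rw [← h1, ← h3, mul_assoc, hc]

/-- A splitting element b' of the target matters only through φ(e)b', which has a preimage even when
b' has none. -/
theorem IsLiftable.mem_nonSplit_iff [FiniteDimensional k E'] (hJ : IsLiftable φ J)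
    {e : E} (he : IsPrimIdem e)
    (heJ : e ∈ J) (hf : IsPrimIdem (φ e)) (a : E) :
    φ a ∈ nonSplit k hf ↔ a ∈ nonSplit k he := by
  constructor
  · intro h b hb
    apply h (φ b)
    simp only [← map_mul, hb]
  · intro h b' hb'
    obtain ⟨j, -, hj⟩ := hJ.lift_right e heJ b'
    have hx : φ (e * j * a * e) = φ e := by
      simp only [map_mul, hj]
      rw [← mul_assoc (φ e) (φ e), hf.idem, hb']
    rcases he.pow_eq_zero_or_inv k (a := e * j * a * e) (by simp only [← mul_assoc, he.idem])
      (by simp only [mul_assoc, he.idem]) with ⟨m, hm⟩ | ⟨d, hd, -⟩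
    · apply hf.ne_zero
      apply eq_zero_of_idem_of_pow_eq_zero hf.idem (m := m)
      rw [← hx, ← map_pow, hm, map_zero]
    · apply h (d * e * j)
      calc e * (d * e * j) * a * e = e * (d * (e * j * a * e)) := by simp only [mul_assoc]
        _ = e := by rw [hd, he.idem]

theorem IsLiftable.exists_quotient_equiv [FiniteDimensional k E'] (hJ : IsLiftable φ J)
    {e : E} (he : IsPrimIdem e)
    (heJ : e ∈ J) (hf : IsPrimIdem (φ e)) :
    ∃ Ψ : (E ⧸ nonSplit k he) ≃ₗ[k] (E' ⧸ nonSplit k hf), ∀ x s, Ψ (x • s) = φ x • Ψ s := by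
  let ψ : E →ₗ[k] (E' ⧸ nonSplit k hf) :=
    ((nonSplit k hf).mkQ.restrictScalars k) ∘ₗ φ.toLinearMap
  have hψ : ∀ a, ψ a = Submodule.Quotient.mk (φ a) := fun a => rfl
  let Ψ : (E ⧸ nonSplit k he) →ₗ[k] (E' ⧸ nonSplit k hf) :=
    { toFun := Quotient.lift (fun a => ψ a) (fun a b hab => by
        rw [hψ, hψ, Submodule.Quotient.eq, ← map_sub, hJ.mem_nonSplit_iff he heJ hf,
          ← Submodule.Quotient.eq]
        exact Quotient.sound hab)
      map_add' := by
        intro s t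
        obtain ⟨a, rfl⟩ := Submodule.Quotient.mk_surjective _ s
        obtain ⟨b, rfl⟩ := Submodule.Quotient.mk_surjective _ t
        exact map_add ψ a b
      map_smul' := by
        intro c s
        obtain ⟨a, rfl⟩ := Submodule.Quotient.mk_surjective _ s
        exact map_smul ψ c a }
  have hΨ : ∀ a, Ψ (Submodule.Quotient.mk a) = Submodule.Quotient.mk (φ a) := fun a => rfl
  refine ⟨LinearEquiv.ofBijective Ψ ⟨?_, ?_⟩, ?_⟩
  · rw [injective_iff_map_eq_zero]
    intro s hs
    obtain ⟨a, rfl⟩ := Submodule.Quotient.mk_surjective _ s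
    rw [hΨ, Submodule.Quotient.mk_eq_zero, hJ.mem_nonSplit_iff he heJ hf] at hs
    rwa [Submodule.Quotient.mk_eq_zero]
  · intro s
    obtain ⟨a, rfl⟩ := Submodule.Quotient.mk_surjective _ s
    -- Modulo `nonSplit` the elements a and aφ(e) agree, and the second one has a preimage; this
    -- replaces surjectivity of φ.
    obtain ⟨j, -, hj⟩ := hJ.lift_left a e heJ
    refine ⟨Submodule.Quotient.mk j, ?_⟩
    rw [hΨ, hj, Submodule.Quotient.eq, mem_nonSplit]
    intro b hb
    apply hf.ne_zero
    rw [← hb]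
    simp only [mul_assoc, sub_mul, hf.idem, sub_self, mul_zero]
  · intro x s
    obtain ⟨a, rfl⟩ := Submodule.Quotient.mk_surjective _ s
    exact congrArg Submodule.Quotient.mk (map_mul φ x a)

theorem IsLiftable.finrank_eq [FiniteDimensional k E'] (hJ : IsLiftable φ J)
    {e : E} (he : IsPrimIdem e)
    (heJ : e ∈ J) (hf : IsPrimIdem (φ e)) :
    Module.finrank k (E ⧸ nonSplit k he) = Module.finrank k (E' ⧸ nonSplit k hf) := by
  obtain ⟨Ψ, -⟩ := hJ.exists_quotient_equiv he heJ hf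
  exact Ψ.finrank_eq

theorem IsLiftable.idemRank_eq [FiniteDimensional k E'] (hJ : IsLiftable φ J)
    {e : E} (he : IsPrimIdem e)
    (heJ : e ∈ J) (hf : IsPrimIdem (φ e)) :
    idemRank k (E ⧸ nonSplit k he) e = idemRank k (E' ⧸ nonSplit k hf) (φ e) := by
  obtain ⟨Ψ, hΨ⟩ := hJ.exists_quotient_equiv he heJ hf
  have : LinearMap.range (Algebra.lsmul k k (E' ⧸ nonSplit k hf) (φ e)) =
      (LinearMap.range (Algebra.lsmul k k (E ⧸ nonSplit k he) e)).map Ψ.toLinearMap := by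
    ext t
    constructor
    · rintro ⟨s, rfl⟩
      refine ⟨_, ⟨Ψ.symm s, rfl⟩, ?_⟩
      have := hΨ e (Ψ.symm s)
      rw [Ψ.apply_symm_apply] at this
      exact this
    · rintro ⟨_, ⟨s, rfl⟩, rfl⟩
      exact ⟨Ψ s, (hΨ e s).symm⟩
  rw [idemRank, idemRank, this]
  exact (LinearEquiv.finrank_map_eq Ψ _).symm

/-- The dimension of uE is the measure that makes the splitting of idempotents terminate. -/
theorem finrank_range_mulLeft_lt {u c : E} (h1 : u * c = c) (h2 : c * u = c) (hc : c * c = c)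
    (hne : c ≠ u) : Module.finrank k (LinearMap.range (LinearMap.mulLeft k c)) <
      Module.finrank k (LinearMap.range (LinearMap.mulLeft k u)) := by
  apply Submodule.finrank_lt_finrank_of_lt
  rw [SetLike.lt_iff_le_and_exists]
  constructor
  · rintro _ ⟨x, rfl⟩
    exact ⟨c * x, by simp [← mul_assoc, h1]⟩
  · refine ⟨u, ⟨1, by simp⟩, ?_⟩
    rintro ⟨x, hx⟩
    rw [LinearMap.mulLeft_apply] at hx
    apply hne
    rw [← h2, ← hx, ← mul_assoc, hc]

/-- If u splits as c + (u - c), primitivity of f forces one part to map to 0 and the other to f. The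
induction continues with the latter, which stays in J because it is a multiple of u. -/
theorem IsLiftable.exists_isPrimIdem_of_idem (hJ : IsLiftable φ J) {f : E'} (hf : IsPrimIdem f)
    (n : ℕ) : ∀ u ∈ J, u * u = u → φ u = f →
      Module.finrank k (LinearMap.range (LinearMap.mulLeft k u)) = n →
      ∃ e ∈ J, IsPrimIdem e ∧ φ e = f := by
  induction n using Nat.strong_induction_on with
  | _ n ih =>
  intro u huJ hu hφ hn
  by_cases hprim : IsPrimIdem u
  · exact ⟨u, huJ, hprim, hφ⟩
  have hu0 : u ≠ 0 := by
    rintro rfl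
    exact hf.ne_zero (by rw [← hφ, map_zero])
  have : ∃ c, c * c = c ∧ u * c = c ∧ c * u = c ∧ c ≠ 0 ∧ c ≠ u := by
    by_contra! hcon
    exact hprim ⟨hu, hu0, fun c h1 h2 h3 => or_iff_not_imp_left.2 fun h4 => hcon c h1 h2 h3 h4⟩
  obtain ⟨c, hc, h1, h2, hc0, hcu⟩ := this
  rcases hf.eq_zero_or_eq (φ c) (by rw [← map_mul, hc]) (by rw [← hφ, ← map_mul, h1])
    (by rw [← hφ, ← map_mul, h2]) with h3 | h3
  · have h4 : (u - c) * (u - c) = u - c := by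
      simp only [sub_mul, mul_sub, hu, hc, h1, h2]
      abel
    have h5 : u * (u - c) = u - c := by rw [mul_sub, hu, h1]
    have h6 : (u - c) * u = u - c := by rw [sub_mul, hu, h2]
    have h7 : u - c ≠ u := fun h => hc0 (by simpa using h)
    exact ih _ (hn ▸ finrank_range_mulLeft_lt (k := k) h5 h6 h4 h7) (u - c)
      (h6 ▸ hJ.mul_left _ _ huJ) h4 (by rw [map_sub, h3, sub_zero, hφ]) rfl
  · exact ih _ (hn ▸ finrank_range_mulLeft_lt (k := k) h1 h2 hc hcu) c
      (h2 ▸ hJ.mul_left _ _ huJ) hc h3 rfl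

theorem IsLiftable.exists_isPrimIdem (hJ : IsLiftable φ J) {j : E} (hj : j ∈ J)
    (hf : IsPrimIdem (φ j)) : ∃ e ∈ J, IsPrimIdem e ∧ φ e = φ j := by
  -- The Fitting idempotent of j is a multiple of j, hence lies in J, and it has the same image as j
  -- because that image is already idempotent.
  obtain ⟨m, z, hc, hu, ha⟩ := exists_idempotent_pow_mul k j
  have hpow : φ j ^ (m + 1) = φ j := (show IsIdempotentElem (φ j) from hf.idem).pow_succ_eq m
  refine hJ.exists_isPrimIdem_of_idem hf _ (j ^ (m + 1) * z) ?_ hu ?_ rfl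
  · rw [pow_succ', mul_assoc]
    exact hJ.mul_right j hj _
  · have h1 := congrArg φ ha
    simp only [map_mul, map_pow, hpow] at h1 ⊢
    rwa [← mul_assoc, hf.idem] at h1

/-- The elements realizing the equivalence lift to x in eEf and y in fEe. As φ(xy) = φ(e) is not
nilpotent, xy is invertible in eEe with some inverse d; then ydx is a nonzero idempotent of fEf, so
it is f. -/
theorem IsLiftable.idemEquiv_iff (hJ : IsLiftable φ J) {e f : E} (he : IsPrimIdem e)
    (heJ : e ∈ J) (he0 : φ e ≠ 0) (hf : IsPrimIdem f) (hfJ : f ∈ J) :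
    IdemEquiv (φ e) (φ f) ↔ IdemEquiv e f := by
  refine ⟨?_, fun h => h.map φ.toRingHom⟩
  rintro ⟨a, b, hab, hba⟩
  have hφe := hJ.isPrimIdem he heJ he0
  obtain ⟨ja, -, hja⟩ := hJ.lift_right e heJ (a * φ f)
  obtain ⟨jb, -, hjb⟩ := hJ.lift_right f hfJ (b * φ e)
  have hee : ∀ x, e * (e * x) = e * x := fun x => by rw [← mul_assoc, he.idem]
  have hff : ∀ x, f * (f * x) = f * x := fun x => by rw [← mul_assoc, hf.idem]
  obtain ⟨x, hx⟩ : ∃ x, x = e * ja * f := ⟨_, rfl⟩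
  obtain ⟨y, hy⟩ : ∃ y, y = f * jb * e := ⟨_, rfl⟩
  have hxe : e * x = x := by rw [hx]; simp only [mul_assoc, hee]
  have hxf : x * f = x := by rw [hx]; simp only [mul_assoc, hf.idem]
  have hye : y * e = y := by rw [hy]; simp only [mul_assoc, he.idem]
  have hyf : f * y = y := by rw [hy]; simp only [mul_assoc, hff]
  have hφx : φ x = φ e * a * φ f := by
    rw [hx]
    simp only [map_mul, hja]
    simp only [mul_assoc, ← map_mul, hf.idem]
    simp only [← mul_assoc, ← map_mul, he.idem]
  have hφy : φ y = φ f * b * φ e := by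
    rw [hy]
    simp only [map_mul, hjb]
    simp only [mul_assoc, ← map_mul, he.idem]
    simp only [← mul_assoc, ← map_mul, hf.idem]
  have hφxy : φ (x * y) = φ e := by
    have hφf2 : φ f * φ f = φ f := by rw [← map_mul, hf.idem]
    calc φ (x * y) = φ e * a * (φ f * φ f) * b * φ e := by
          rw [map_mul, hφx, hφy]; simp only [mul_assoc]
      _ = φ e * ((a * b) * (a * b)) * φ e := by
          rw [hφf2, ← hba]; simp only [mul_assoc]
      _ = φ e := by rw [hab, hφe.idem, hφe.idem, hφe.idem]
  rcases he.pow_eq_zero_or_inv k (a := x * y) (by rw [← mul_assoc, hxe])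
    (by rw [mul_assoc, hye]) with ⟨m, hm⟩ | ⟨d, -, hd⟩
  · exfalso
    apply he0
    apply eq_zero_of_idem_of_pow_eq_zero hφe.idem (m := m)
    rw [← hφxy, ← map_pow, hm, map_zero]
  · have hd' : x * (y * d) = e := by rw [← mul_assoc, hd]
    have hw : (y * d * x) * (y * d * x) = y * d * x := by
      calc _ = y * d * (x * (y * d)) * x := by simp only [mul_assoc]
        _ = _ := by rw [hd', mul_assoc (y * d), hxe]
    rcases hf.eq_zero_or_eq _ hw (by simp only [← mul_assoc, hyf])
      (by simp only [mul_assoc, hxf]) with h0 | h1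
    · exfalso
      apply he.ne_zero
      calc e = x * (y * d) * (x * (y * d)) := by rw [hd', he.idem]
        _ = x * (y * d * x) * (y * d) := by simp only [mul_assoc]
        _ = 0 := by rw [h0]; simp
    · exact ⟨x, y * d, hd', h1⟩

end Idempotents

/-! ### Components and idempotent endomorphisms -/

section ComponentIdem

variable {A V : Type*} [Ring A] [AddCommGroup V] [Module A V]

theorem idem_apply_of_mem_range {e : Module.End A V} (he : e * e = e) {v : V}
    (hv : v ∈ LinearMap.range e) : e v = v := by
  obtain ⟨w, rfl⟩ := hv
  exact LinearMap.congr_fun he w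

theorem exists_idem_of_isComplemented {W : Submodule A V} (h : IsComplemented W) :
    ∃ e : Module.End A V, e * e = e ∧ LinearMap.range e = W := by
  obtain ⟨W', hW⟩ := h
  exact ⟨W.projection W' hW, Submodule.isIdempotentElem_projection hW,
    Submodule.range_projection hW⟩

theorem isComplemented_range {e : Module.End A V} (he : e * e = e) :
    IsComplemented (LinearMap.range e) :=
  ⟨LinearMap.ker e, (LinearMap.IsIdempotentElem.isCompl he)⟩

/-- Idempotents of eEe are the projections of the direct sum decompositions of eV. -/
theorem isIndecomposable_range_iff {e : Module.End A V} (he : e * e = e) :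
    IsIndecomposable A (LinearMap.range e) ↔ IsPrimIdem e := by
  constructor
  · rintro ⟨hnt, hind⟩
    refine ⟨he, ?_, fun c hc h1 h2 => ?_⟩
    · rintro rfl
      rw [LinearMap.range_zero] at hnt
      exact not_subsingleton _ (inferInstance : Subsingleton (⊥ : Submodule A V))
    · have hce : ∀ v ∈ LinearMap.range e, c v ∈ LinearMap.range e := fun v _ =>
        ⟨c v, LinearMap.congr_fun h1 v⟩
      let c' : Module.End A (LinearMap.range e) := c.restrict hce
      have hc' : c' * c' = c' := by
        ext v
        exact LinearMap.congr_fun hc v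
      have hcv : ∀ v, c v = c' (e.rangeRestrict v) := fun v => (LinearMap.congr_fun h2 v).symm
      rcases hind _ _ (LinearMap.IsIdempotentElem.isCompl hc') with h | h
      · left
        ext v
        rw [hcv, LinearMap.range_eq_bot.1 h]
        rfl
      · right
        ext v
        have h3 : e.rangeRestrict v - c' (e.rangeRestrict v) ∈ LinearMap.ker c' := by
          rw [LinearMap.mem_ker, map_sub, sub_eq_zero]
          exact (LinearMap.congr_fun hc' _).symm
        rw [h, Submodule.mem_bot, sub_eq_zero] at h3
        rw [hcv, ← h3]
        rfl
  · intro hp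
    have hmem : ∀ v, e v ∈ LinearMap.range e := fun v => ⟨v, rfl⟩
    refine ⟨?_, fun U W hUW => ?_⟩
    · obtain ⟨v, hv⟩ : ∃ v, e v ≠ 0 := by
        by_contra! h
        exact hp.ne_zero (LinearMap.ext h)
      exact ⟨⟨e v, hmem v⟩, 0, fun h => hv (congrArg Subtype.val h)⟩
    · let c : Module.End A V :=
        (LinearMap.range e).subtype ∘ₗ U.projection W hUW ∘ₗ e.rangeRestrict
      have hr : ∀ w : LinearMap.range e, e.rangeRestrict w = w := fun w =>
        Subtype.ext (idem_apply_of_mem_range he w.2)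
      have hcw : ∀ w : LinearMap.range e, c w = (U.projection W hUW w : V) := fun w => by
        simp [c, hr]
      have hcv : ∀ v, c v = (U.projection W hUW (e.rangeRestrict v) : V) := fun v => rfl
      have h1 : c * c = c := by
        ext v
        change c (c v) = c v
        rw [hcv v, hcw]
        exact congrArg _ (LinearMap.congr_fun (Submodule.isIdempotentElem_projection hUW) _)
      have h2 : e * c = c := by
        ext v
        exact idem_apply_of_mem_range he (Subtype.prop _)
      have h3 : c * e = c := by
        ext v
        change c (e v) = c v
        rw [hcv v, hcv, hr ⟨e v, hmem v⟩]
        rfl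
      rcases hp.eq_zero_or_eq c h1 h2 h3 with h | h
      · left
        rw [eq_bot_iff]
        intro u hu
        have := hcw u
        rw [Submodule.projection_apply_left hUW ⟨u, hu⟩, h] at this
        exact Subtype.ext this.symm
      · right
        rw [eq_bot_iff]
        intro w hw
        have := hcw w
        rw [(Submodule.projection_apply_eq_zero_iff hUW).2 hw, h,
          idem_apply_of_mem_range he w.2] at this
        exact Subtype.ext this

theorem nonempty_equiv_range_iff {e f : Module.End A V} (he : e * e = e) (hf : f * f = f) :
    Nonempty (LinearMap.range e ≃ₗ[A] LinearMap.range f) ↔ IdemEquiv e f := by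
  constructor
  · rintro ⟨g⟩
    have hr : ∀ w : LinearMap.range e, e.rangeRestrict w = w := fun w =>
      Subtype.ext (idem_apply_of_mem_range he w.2)
    have hr' : ∀ w : LinearMap.range f, f.rangeRestrict w = w := fun w =>
      Subtype.ext (idem_apply_of_mem_range hf w.2)
    refine ⟨(LinearMap.range e).subtype ∘ₗ g.symm.toLinearMap ∘ₗ f.rangeRestrict,
      (LinearMap.range f).subtype ∘ₗ g.toLinearMap ∘ₗ e.rangeRestrict, ?_, ?_⟩
    · ext v
      simp [hr']
    · ext v
      simp [hr]
  · rintro ⟨a, b, hab, hba⟩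
    have hab' : ∀ v, a (b v) = e v := LinearMap.congr_fun hab
    have hba' : ∀ v, b (a v) = f v := LinearMap.congr_fun hba
    have hb : ∀ v ∈ LinearMap.range e, b v ∈ LinearMap.range f := fun v hv =>
      ⟨b v, by rw [← hba', hab', idem_apply_of_mem_range he hv]⟩
    have ha : ∀ v ∈ LinearMap.range f, a v ∈ LinearMap.range e := fun v hv =>
      ⟨a v, by rw [← hab', hba', idem_apply_of_mem_range hf hv]⟩
    refine ⟨LinearEquiv.ofLinearMap (b.restrict hb) (a.restrict ha) ?_ ?_⟩
    · ext v
      exact (hba' v).trans (idem_apply_of_mem_range hf v.2)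
    · ext v
      exact (hab' v).trans (idem_apply_of_mem_range he v.2)

theorem IsDecomposition.exists_idempotents {n : ℕ} {D : Fin n → Submodule A V}
    (hD : IsDecomposition A D) : ∃ g : Fin n → Module.End A V, CompleteOrthogonalIdempotents g ∧
      (∀ i, IsPrimIdem (g i)) ∧ ∀ i, LinearMap.range (g i) = D i := by
  obtain ⟨hint, hind⟩ := hD
  let Ψ := LinearEquiv.ofBijective (DirectSum.coeLinearMap D) hint
  have hΨ : ∀ i (w : D i), Ψ.symm w = DirectSum.of (fun i => D i) i w := fun i w => by
    rw [LinearEquiv.symm_apply_eq]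
    exact (DirectSum.coeLinearMap_of D i w).symm
  let g : Fin n → Module.End A V := fun i =>
    (D i).subtype ∘ₗ DirectSum.component A (Fin n) (fun i => D i) i ∘ₗ Ψ.symm.toLinearMap
  have hg : ∀ i v, g i v = (Ψ.symm v i : V) := fun i v => rfl
  have hgi : ∀ i (w : D i), g i w = w := fun i w => by
    rw [hg, hΨ, DirectSum.of_eq_same]
  have hgij : ∀ i j, i ≠ j → ∀ w : D i, g j w = 0 := fun i j hij w => by
    rw [hg, hΨ, DirectSum.of_eq_of_ne _ _ _ hij.symm]
    rfl
  have hidem : ∀ i, g i * g i = g i := fun i => LinearMap.ext fun v => hgi i _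
  have hrange : ∀ i, LinearMap.range (g i) = D i := fun i => by
    apply le_antisymm
    · rintro _ ⟨v, rfl⟩
      exact Subtype.prop _
    · exact fun w hw => ⟨w, hgi i ⟨w, hw⟩⟩
  refine ⟨g, ⟨⟨hidem, fun i j hij => LinearMap.ext fun v => hgij j i hij.symm _⟩, ?_⟩, ?_, hrange⟩
  · ext v
    conv_rhs => rw [← Ψ.apply_symm_apply v]
    rw [LinearMap.sum_apply]
    change ∑ i, (Ψ.symm v i : V) = DirectSum.coeLinearMap D (Ψ.symm v)
    classical
    rw [DirectSum.coeLinearMap_eq_dfinsuppSum, DFinsupp.sum_eq_sum_fintype]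
    · simp
    · exact fun i => rfl
  · intro i
    rw [← isIndecomposable_range_iff (hidem i), hrange]
    exact hind i

theorem isDecomposition_range {n : ℕ} {g : Fin n → Module.End A V}
    (hg : CompleteOrthogonalIdempotents g) (hp : ∀ i, IsPrimIdem (g i)) :
    IsDecomposition A fun i => LinearMap.range (g i) := by
  refine ⟨?_, fun i => (isIndecomposable_range_iff (hp i).idem).2 (hp i)⟩
  rw [DirectSum.isInternal_submodule_iff_iSupIndep_and_iSup_eq_top]
  constructor
  · rw [iSupIndep_iff_finsetSum_eq_zero_imp_eq_zero]
    intro s v hv hs i hi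
    have h := congrArg (g i) hs
    rw [map_sum, map_zero, Finset.sum_eq_single_of_mem i hi] at h
    · rwa [idem_apply_of_mem_range (hg.idem i) (hv i hi)] at h
    · intro j hj hji
      rw [← idem_apply_of_mem_range (hg.idem j) (hv j hj)]
      exact LinearMap.congr_fun (hg.ortho hji.symm) _
  · rw [eq_top_iff]
    intro v _
    have : v = ∑ i, g i v := by
      rw [← LinearMap.sum_apply, hg.complete]
      rfl
    rw [this]
    exact sum_mem fun i _ => Submodule.mem_iSup_of_mem i ⟨v, rfl⟩

end ComponentIdem

/-- Splitting u = c + (u - c) repeatedly. Idempotents from different parts are orthogonal because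
they lie in the corners of c and of u - c. -/
theorem exists_orthogonal_primIdem (k : Type*) {E : Type*} [Field k] [Ring E] [Algebra k E]
    [FiniteDimensional k E] (n : ℕ) : ∀ u : E, u * u = u →
      Module.finrank k (LinearMap.range (LinearMap.mulLeft k u)) = n →
      ∃ (ι : Type) (_ : Fintype ι) (g : ι → E), OrthogonalIdempotents g ∧
        (∀ i, IsPrimIdem (g i)) ∧ ∑ i, g i = u := by
  induction n using Nat.strong_induction_on with
  | _ n ih =>
  intro u hu hn
  by_cases hu0 : u = 0
  · exact ⟨Empty, inferInstance, fun i => i.elim, ⟨fun i => i.elim, fun i => i.elim⟩,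
      fun i => i.elim, by simp [hu0]⟩
  by_cases hprim : IsPrimIdem u
  · exact ⟨Unit, inferInstance, fun _ => u,
      ⟨fun _ => hu, fun i j hij => (hij (Subsingleton.elim i j)).elim⟩, fun _ => hprim, by simp⟩
  have : ∃ c, c * c = c ∧ u * c = c ∧ c * u = c ∧ c ≠ 0 ∧ c ≠ u := by
    by_contra! hcon
    exact hprim ⟨hu, hu0, fun c h1 h2 h3 => or_iff_not_imp_left.2 fun h4 => hcon c h1 h2 h3 h4⟩
  obtain ⟨c, hc, h1, h2, hc0, hcu⟩ := this
  have h4 : (u - c) * (u - c) = u - c := by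
    simp only [sub_mul, mul_sub, hu, hc, h1, h2]
    abel
  have h5 : u * (u - c) = u - c := by rw [mul_sub, hu, h1]
  have h6 : (u - c) * u = u - c := by rw [sub_mul, hu, h2]
  have h7 : u - c ≠ u := fun h => hc0 (by simpa using h)
  obtain ⟨ι, _, g, hg, hgp, hgs⟩ :=
    ih _ (hn ▸ finrank_range_mulLeft_lt (k := k) h1 h2 hc hcu) c hc rfl
  obtain ⟨κ, _, l, hl, hlp, hls⟩ :=
    ih _ (hn ▸ finrank_range_mulLeft_lt (k := k) h5 h6 h4 h7) (u - c) h4 rfl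
  classical
  have hgc : ∀ i, c * g i = g i ∧ g i * c = g i := fun i => by
    rw [← hgs, Finset.sum_mul, Finset.mul_sum]
    simp [hg.mul_eq]
  have hlc : ∀ i, (u - c) * l i = l i ∧ l i * (u - c) = l i := fun i => by
    rw [← hls, Finset.sum_mul, Finset.mul_sum]
    simp [hl.mul_eq]
  have hcd : c * (u - c) = 0 := by rw [mul_sub, h2, hc, sub_self]
  have hdc : (u - c) * c = 0 := by rw [sub_mul, h1, hc, sub_self]
  refine ⟨ι ⊕ κ, inferInstance, Sum.elim g l, ⟨?_, ?_⟩, ?_, ?_⟩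
  · rintro (i | i)
    exacts [hg.idem i, hl.idem i]
  · rintro (i | i) (j | j) hij
    · exact hg.ortho fun h => hij (congrArg _ h)
    · change g i * l j = 0
      rw [← (hgc i).2, ← (hlc j).1, mul_assoc, ← mul_assoc c, hcd, zero_mul, mul_zero]
    · change l i * g j = 0
      rw [← (hlc i).2, ← (hgc j).1, mul_assoc, ← mul_assoc (u - c), hdc, zero_mul, mul_zero]
    · exact hl.ortho fun h => hij (congrArg _ h)
  · rintro (i | i)
    exacts [hgp i, hlp i]
  · simp [hgs, hls]

/-! ### Existence and uniqueness of multiplicities -/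

section Multiplicity

variable (k : Type*) {A V : Type*} [Field k] [Ring A] [Algebra k A] [AddCommGroup V] [Module A V]
  [Module k V] [IsScalarTower k A V]

instance finiteDimensional_end [FiniteDimensional k V] : FiniteDimensional k (Module.End A V) :=
  FiniteDimensional.of_injective
    (LinearMap.restrictScalarsₗ k A V V k) (LinearMap.restrictScalars_injective k)

theorem exists_isDecomposition [FiniteDimensional k V] :
    ∃ (n : ℕ) (D : Fin n → Submodule A V), IsDecomposition A D := by
  obtain ⟨ι, _, g, hg, hp, hs⟩ :=
    exists_orthogonal_primIdem k _ (1 : Module.End A V) (mul_one _) rfl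
  let σ := (Fintype.equivFin ι).symm
  refine ⟨_, _, isDecomposition_range (g := g ∘ σ) ⟨⟨fun i => hg.idem _, fun i j hij =>
    hg.ortho fun h => hij (σ.injective h)⟩, ?_⟩ fun i => hp _⟩
  rw [← hs]
  exact σ.sum_comp g

theorem hasMultiplicity_of_idem [FiniteDimensional k V] {e : Module.End A V} (he : IsPrimIdem e)
    {M : Type*} [AddCommGroup M] [Module A M] (hM : Nonempty (LinearMap.range e ≃ₗ[A] M)) :
    HasMultiplicity A V M (Module.finrank k (Module.End A V ⧸ nonSplit k he) /
      idemRank k (Module.End A V ⧸ nonSplit k he) e) := by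
  refine ⟨exists_isDecomposition k, fun n D hD => ?_⟩
  obtain ⟨g, hg, hp, hr⟩ := hD.exists_idempotents
  obtain ⟨hM⟩ := hM
  rw [← card_idemEquiv_mul he hg hp, Nat.mul_div_cancel _ (idemRank_self_pos he)]
  refine Nat.card_congr (Equiv.subtypeEquivRight fun i => ?_)
  rw [← nonempty_equiv_range_iff (hp i).idem he.idem, hr]
  exact ⟨fun ⟨x⟩ => ⟨x.trans hM.symm⟩, fun ⟨x⟩ => ⟨x.trans hM⟩⟩

end Multiplicity

/-! ### Correspondences of components from homomorphisms of endomorphism algebras -/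

section Correspondence

theorem Component.exists_idem {A V : Type*} [Ring A] [AddCommGroup V] [Module A V]
    {P : Submodule A V → Prop} (U : Component A V P) :
    ∃ e : Module.End A V, IsPrimIdem e ∧ LinearMap.range e = U.1 := by
  obtain ⟨e, he, hr⟩ := exists_idem_of_isComplemented U.2.1.2
  refine ⟨e, ?_, hr⟩
  rw [← isIndecomposable_range_iff he, hr]
  exact U.2.1.1

theorem isComponent_range {A V : Type*} [Ring A] [AddCommGroup V] [Module A V]
    {e : Module.End A V} (he : IsPrimIdem e) : IsComponent A (LinearMap.range e) :=
  ⟨(isIndecomposable_range_iff he.idem).2 he, isComplemented_range he.idem⟩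

variable (k : Type*) {A B V W : Type*} [Field k] [Ring A] [Algebra k A] [Ring B] [Algebra k B]
  [AddCommGroup V] [Module A V] [Module k V] [IsScalarTower k A V] [FiniteDimensional k V]
  [AddCommGroup W] [Module B W] [Module k W] [IsScalarTower k B W] [FiniteDimensional k W]
  {P : Submodule A V → Prop} {R : Submodule B W → Prop}

/-- The quotient of dimensions that computes the multiplicity is the same for e and φ(e), since φ
identifies the two simple modules. -/
theorem IsLiftable.exists_hasMultiplicity {φ : Module.End A V →ₐ[k] Module.End B W}
    {J : Set (Module.End A V)} (hJ : IsLiftable φ J) {e : Module.End A V} (he : IsPrimIdem e)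
    (heJ : e ∈ J) (h0 : φ e ≠ 0) {M N : Type*} [AddCommGroup M] [Module A M] [AddCommGroup N]
    [Module B N] (hM : Nonempty (LinearMap.range e ≃ₗ[A] M))
    (hN : Nonempty (LinearMap.range (φ e) ≃ₗ[B] N)) :
    ∃ m, HasMultiplicity A V M m ∧ HasMultiplicity B W N m := by
  have hf := hJ.isPrimIdem he heJ h0
  refine ⟨_, hasMultiplicity_of_idem k he hM, ?_⟩
  rw [hJ.finrank_eq he heJ hf, hJ.idemRank_eq he heJ hf]
  exact hasMultiplicity_of_idem k hf hN

theorem IsLiftable.exists_multiplicityPreserving {φ : Module.End A V →ₐ[k] Module.End B W}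
    {J : Set (Module.End A V)} (hJ : IsLiftable φ J)
    (hP : ∀ e, IsPrimIdem e → (P (LinearMap.range e) ↔ e ∈ J ∧ φ e ≠ 0))
    (hR : ∀ f, IsPrimIdem f → (R (LinearMap.range f) ↔ ∃ j ∈ J, φ j = f)) :
    ∃ Φ : ComponentType A V P ≃ ComponentType B W R, MultiplicityPreserving Φ := by
  -- The idempotent depends on a choice of complement, but its equivalence class does not, so the
  -- map is canonical on isomorphism types.
  choose ε hε hεr using fun U : Component A V P => U.exists_idem
  have hεJ : ∀ U, ε U ∈ J ∧ φ (ε U) ≠ 0 := fun U => (hP _ (hε U)).1 (hεr U ▸ U.2.2)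
  have hφε : ∀ U, IsPrimIdem (φ (ε U)) := fun U => hJ.isPrimIdem (hε U) (hεJ U).1 (hεJ U).2
  let F : Component A V P → Component B W R := fun U =>
    ⟨LinearMap.range (φ (ε U)), isComponent_range (hφε U),
      (hR _ (hφε U)).2 ⟨_, (hεJ U).1, rfl⟩⟩
  have hF : ∀ U U', F U ≈ F U' ↔ U ≈ U' := by
    intro U U'
    change Nonempty (_ ≃ₗ[B] _) ↔ Nonempty (_ ≃ₗ[A] _)
    rw [nonempty_equiv_range_iff (hφε U).idem (hφε U').idem,
      hJ.idemEquiv_iff (hε U) (hεJ U).1 (hεJ U).2 (hε U') (hεJ U').1,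
      ← nonempty_equiv_range_iff (hε U).idem (hε U').idem, hεr, hεr]
  let Φ : ComponentType A V P → ComponentType B W R :=
    Quotient.map F fun U U' h => (hF U U').2 h
  have hΦ : Function.Bijective Φ := by
    constructor
    · rintro ⟨U⟩ ⟨U'⟩ h
      exact Quotient.sound ((hF U U').1 (Quotient.exact h))
    · rintro ⟨U'⟩
      obtain ⟨f, hf, hr⟩ := U'.exists_idem
      obtain ⟨j, hj, rfl⟩ := (hR f hf).1 (hr ▸ U'.2.2)
      obtain ⟨e, heJ, he, hej⟩ := hJ.exists_isPrimIdem hj hf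
      rw [← hej] at hf hr
      let U : Component A V P := ⟨LinearMap.range e, isComponent_range he,
        (hP e he).2 ⟨heJ, hf.ne_zero⟩⟩
      refine ⟨Quotient.mk _ U, Quotient.sound ?_⟩
      change Nonempty (_ ≃ₗ[B] _)
      rw [← hr, nonempty_equiv_range_iff (hφε U).idem hf.idem,
        hJ.idemEquiv_iff (hε U) (hεJ U).1 (hεJ U).2 he heJ,
        ← nonempty_equiv_range_iff (hε U).idem he.idem, hεr]
      exact ⟨LinearEquiv.refl _ _⟩
  refine ⟨Equiv.ofBijective Φ hΦ, fun U U' h => ?_⟩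
  exact hJ.exists_hasMultiplicity k (hε U) (hεJ U).1 (hεJ U).2
    ⟨LinearEquiv.ofEq _ _ (hεr U)⟩ (Quotient.exact h)

/-- When φ is the conjugation by σ, it carries the image of an idempotent to its translate by σ. The
correspondence then exists for the submodules themselves, and the lifting ideal may be taken to be
everything. -/
theorem exists_equiv_of_algEquiv (φ : Module.End A V ≃ₐ[k] Module.End B W) (σ : V ≃ W)
    (hσ : ∀ T v, φ T (σ v) = σ (T v))
    (hPR : ∀ e, IsPrimIdem e → (P (LinearMap.range e) ↔ R (LinearMap.range (φ e)))) :
    ∃ (F : Component A V P ≃ Component B W R) (Φ : ComponentType A V P ≃ ComponentType B W R),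
      (∀ U, ((F U).1 : Set W) = σ '' U.1) ∧ (∀ U, Φ (Quotient.mk _ U) = Quotient.mk _ (F U)) ∧
      MultiplicityPreserving Φ := by
  have hJ : IsLiftable φ.toAlgHom Set.univ :=
    ⟨fun _ _ _ => trivial, fun _ _ _ => trivial,
      fun c j _ => ⟨φ.symm c * j, trivial, by simp⟩,
      fun j _ c => ⟨j * φ.symm c, trivial, by simp⟩⟩
  have hrange : ∀ T, (LinearMap.range (φ T) : Set W) = σ '' (LinearMap.range T) := by
    intro T
    ext w
    constructor
    · rintro ⟨w', rfl⟩
      obtain ⟨v, rfl⟩ := σ.surjective w'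
      exact ⟨T v, ⟨v, rfl⟩, (hσ T v).symm⟩
    · rintro ⟨_, ⟨v, rfl⟩, rfl⟩
      exact ⟨σ v, hσ T v⟩
  have hne : ∀ {e}, IsPrimIdem e → φ e ≠ 0 := fun he h =>
    he.ne_zero (by simpa using h)
  have hprim : ∀ {e}, IsPrimIdem e → IsPrimIdem (φ e) := fun he =>
    hJ.isPrimIdem he trivial (hne he)
  choose ε hε hεr using fun U : Component A V P => U.exists_idem
  let F : Component A V P → Component B W R := fun U =>
    ⟨LinearMap.range (φ (ε U)), isComponent_range (hprim (hε U)),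
      (hPR _ (hε U)).1 (hεr U ▸ U.2.2)⟩
  have hFσ : ∀ U, ((F U).1 : Set W) = σ '' U.1 := fun U => by
    rw [← hεr U]
    exact hrange _
  have hF : Function.Bijective F := by
    constructor
    · intro U U' h
      have h2 := hFσ U
      rw [h, hFσ U'] at h2
      exact Subtype.ext (SetLike.coe_injective (σ.injective.image_injective h2.symm))
    · intro U'
      obtain ⟨f, hf, hr⟩ := U'.exists_idem
      have he : IsPrimIdem (φ.symm f) := by
        refine ⟨by rw [← map_mul, hf.idem], by simpa using hf.ne_zero, fun c h1 h2 h3 => ?_⟩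
        rcases hf.eq_zero_or_eq (φ c) (by rw [← map_mul, h1])
          (by conv_rhs => rw [← h2, map_mul, φ.apply_symm_apply])
          (by conv_rhs => rw [← h3, map_mul, φ.apply_symm_apply]) with h | h
        · exact Or.inl (by simpa using h)
        · exact Or.inr (by rw [← h, φ.symm_apply_apply])
      refine ⟨⟨LinearMap.range (φ.symm f), isComponent_range he, (hPR _ he).2 ?_⟩, ?_⟩
      · rw [φ.apply_symm_apply, hr]
        exact U'.2.2
      · apply Subtype.ext
        apply SetLike.coe_injective
        rw [hFσ, ← hrange, φ.apply_symm_apply, hr]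
  have hF' : ∀ U U', U ≈ U' ↔ F U ≈ F U' := by
    intro U U'
    change Nonempty (_ ≃ₗ[A] _) ↔ Nonempty (_ ≃ₗ[B] _)
    rw [nonempty_equiv_range_iff (hprim (hε U)).idem (hprim (hε U')).idem]
    refine Iff.trans ?_
      (hJ.idemEquiv_iff (hε U) trivial (hne (hε U)) (hε U') trivial).symm
    rw [← nonempty_equiv_range_iff (hε U).idem (hε U').idem, hεr, hεr]
  refine ⟨Equiv.ofBijective F hF, Quotient.congr (Equiv.ofBijective F hF) hF', hFσ,
    fun U => rfl, fun U U' h => ?_⟩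
  exact hJ.exists_hasMultiplicity k (hε U) trivial (hne (hε U))
    ⟨LinearEquiv.ofEq _ _ (hεr U)⟩ (Quotient.exact h)

end Correspondence

/-! ### Relative projectivity and traces -/

section Trace

open MonoidAlgebra (single)

variable {k Γ : Type*} [Field k] [Group Γ]

theorem sum_out_mul_left {T : Type*} [AddCommMonoid T] {H : Subgroup Γ} [Fintype (Γ ⧸ H)]
    {F : Γ → T} (hF : ∀ g, ∀ h ∈ H, F (g * h) = F g) (x : Γ) :
    ∑ t : Γ ⧸ H, F (x * t.out) = ∑ t : Γ ⧸ H, F t.out := by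
  have hF' : ∀ g g' : Γ, (g : Γ ⧸ H) = g' → F g = F g' := fun g g' h => by
    rw [← hF g _ (QuotientGroup.eq.1 h), mul_inv_cancel_left]
  refine Fintype.sum_equiv (MulAction.toPerm x) _ _ fun t => hF' _ _ ?_
  rw [QuotientGroup.out_eq']
  change x • ((t.out : Γ) : Γ ⧸ H) = _
  rw [QuotientGroup.out_eq']
  rfl

theorem apply_out_mk {T : Type*} {H : Subgroup Γ} {F : Γ → T}
    (hF : ∀ g, ∀ h ∈ H, F (g * h) = F g) (x : Γ) : F (x : Γ ⧸ H).out = F x := by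
  rw [← hF _ _ (QuotientGroup.eq.1 (QuotientGroup.out_eq' (x : Γ ⧸ H))), mul_inv_cancel_left]

section

variable {M : Type*} [AddCommGroup M] [Module k[Γ] M] [Module k M] [IsScalarTower k k[Γ] M]

/-- Higman's criterion for the trivial subgroup: the identity of a free module is a trace, this
passes to summands, and conversely averaging a k-linear section gives an equivariant one. -/
theorem projective_iff_exists_trace [Fintype Γ] :
    Module.Projective k[Γ] M ↔ ∃ θ : M →ₗ[k] M, ∀ m,
      ∑ g : Γ, single g (1 : k) • θ (single g⁻¹ (1 : k) • m) = m := by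
  classical
  constructor
  · rintro ⟨s, hs⟩
    -- In each coordinate c keeps only the coefficient at the identity of the group; the conjugates
    -- of c sum to the identity map.
    let c : (M →₀ k[Γ]) →ₗ[k] (M →₀ k[Γ]) := Finsupp.mapRange.linearMap
      ((Algebra.linearMap k k[Γ]) ∘ₗ Finsupp.lapply 1 ∘ₗ
        (MonoidAlgebra.coeffLinearEquiv k).toLinearMap)
    have hc' : ∀ x : k[Γ], ∑ g : Γ, single g (1 : k) *
        algebraMap k k[Γ] ((single g⁻¹ (1 : k) * x).coeff 1) = x := by
      intro x
      induction x using MonoidAlgebra.induction_linear with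
      | zero => simp
      | add x y hx hy =>
        conv_rhs => rw [← hx, ← hy]
        simp only [mul_add, MonoidAlgebra.coeff_add, Finsupp.add_apply, map_add,
          Finset.sum_add_distrib]
      | single h r =>
        rw [Finset.sum_eq_single h]
        · simp [MonoidAlgebra.single_mul_single]
        · intro g _ hg
          have : g⁻¹ * h ≠ 1 := fun h' => hg (inv_mul_eq_one.1 h')
          simp [MonoidAlgebra.single_mul_single, this]
        · simp
    have hc : ∀ a : M →₀ k[Γ],
        ∑ g : Γ, single g (1 : k) • c (single g⁻¹ (1 : k) • a) = a := by
      intro a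
      ext1 m
      rw [Finsupp.finsetSum_apply]
      exact hc' (a m)
    refine ⟨((Finsupp.linearCombination k[Γ] id).restrictScalars k) ∘ₗ c ∘ₗ
      (s.restrictScalars k), fun m => ?_⟩
    have := congrArg (Finsupp.linearCombination k[Γ] id) (hc (s m))
    rw [hs m] at this
    conv_rhs => rw [← this]
    simp [map_sum]
  · rintro ⟨θ, hθ⟩
    obtain ⟨t, ht⟩ := ((Finsupp.linearCombination k[Γ] (id : M → M)).restrictScalars
      k).exists_rightInverse_of_surjective (by
        rw [LinearMap.range_eq_top]
        intro m
        exact ⟨Finsupp.single m 1, by simp⟩)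
    have ht' : ∀ m, Finsupp.linearCombination k[Γ] (id : M → M) (t m) = m := LinearMap.congr_fun ht
    refine ⟨(t ∘ₗ θ).sumOfConjugatesEquivariant Γ, fun m => ?_⟩
    rw [LinearMap.sumOfConjugatesEquivariant_apply, map_sum]
    conv_rhs => rw [← hθ m]
    refine Fintype.sum_equiv (Equiv.inv Γ) _ _ fun g => ?_
    rw [LinearMap.conjugate_apply, map_smul, LinearMap.comp_apply, ht', Equiv.inv_apply, inv_inv]

end

theorem single_one_smul_asModule {V : Type*} [AddCommGroup V] [Module k V]
    (ρ : Representation k Γ V) (g : Γ) (v : ρ.asModule) :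
    single g (1 : k) • v = ρ.asModuleEquiv.symm (ρ g (ρ.asModuleEquiv v)) := by
  rw [Representation.single_smul, one_smul]
  rfl

theorem IndV_mk_mul {H : Subgroup Γ} {L : Type*} [AddCommGroup L] [Module k L]
    (σ : Representation k H L) (s : H) (h : Γ) (a : L) :
    Representation.IndV.mk H.subtype σ (s * h) (σ s a) = Representation.IndV.mk H.subtype σ h a := by
  have := Representation.Coinvariants.mk_self_apply (Representation.tprod
    ((Representation.leftRegular k Γ).comp H.subtype) σ) s (TensorProduct.tmul k (single h 1) a)
  rw [Representation.tprod_apply, TensorProduct.map_tmul] at this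
  simpa using this

/-- A family of maps `L → N` indexed by `Γ` that is compatible with the action of `H` gives a map
from the induced module to `N`. -/
noncomputable def indLift {H : Subgroup Γ} {L N : Type*} [AddCommGroup L] [Module k L]
    [AddCommGroup N] [Module k N] (σ : Representation k H L) (f : Γ → L →ₗ[k] N)
    (hf : ∀ (s : H) h a, f (s * h) (σ s a) = f h a) :
    Representation.IndV H.subtype σ →ₗ[k] N :=
  Representation.Coinvariants.lift _
    (TensorProduct.lift <| (Finsupp.lift _ _ _ f) ∘ₗ
      (MonoidAlgebra.coeffLinearEquiv k).toLinearMap) (by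
    intro s
    ext h a
    simp [hf])

theorem indLift_mk {H : Subgroup Γ} {L N : Type*} [AddCommGroup L] [Module k L]
    [AddCommGroup N] [Module k N] (σ : Representation k H L) (f : Γ → L →ₗ[k] N)
    (hf : ∀ (s : H) h a, f (s * h) (σ s a) = f h a) (h : Γ) (a : L) :
    indLift σ f hf (Representation.IndV.mk H.subtype σ h a) = f h a := by
  simp [indLift]

/-- An induced module is the direct sum of translates of L indexed by cosets. Here θ is the
projection onto the summand of the coset H, and its conjugates are the projections onto the others.
-/
theorem exists_ind_trace {H : Subgroup Γ} [Fintype (Γ ⧸ H)] {L : Type*} [AddCommGroup L]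
    [Module k L] (σ : Representation k H L) :
    ∃ θ : (Representation.ind H.subtype σ).asModule →ₗ[k]
        (Representation.ind H.subtype σ).asModule,
      (∀ s ∈ H, ∀ m, θ (single s (1 : k) • m) = single s (1 : k) • θ m) ∧
      ∀ m, ∑ t : Γ ⧸ H, single t.out (1 : k) • θ (single t.out⁻¹ (1 : k) • m) = m := by
  classical
  let ρ := Representation.ind H.subtype σ
  let mk := Representation.IndV.mk H.subtype σ
  let θ : Representation.IndV H.subtype σ →ₗ[k] Representation.IndV H.subtype σ :=
    indLift σ (fun h => if h ∈ H then mk h else 0) (by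
      intro s h a
      simp only [Subgroup.mul_mem_cancel_left H s.2]
      split_ifs
      · exact IndV_mk_mul σ s h a
      · rfl)
  have hθ : ∀ h a, θ (mk h a) = if h ∈ H then mk h a else 0 := by
    intro h a
    rw [show θ (mk h a) = _ from indLift_mk σ _ _ h a]
    split_ifs <;> rfl
  have hρ : ∀ g h a, ρ g (mk h a) = mk (h * g⁻¹) a := Representation.ind_mk H.subtype σ
  have h1 : ∀ s ∈ H, θ ∘ₗ ρ s = ρ s ∘ₗ θ := by
    intro s hs
    apply Representation.IndV.hom_ext
    intro h
    ext a
    change θ (ρ s (mk h a)) = ρ s (θ (mk h a))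
    rw [hρ, hθ, hθ, Subgroup.mul_mem_cancel_right H (inv_mem hs)]
    split_ifs
    · rw [hρ]
    · rw [map_zero]
  have h2 : ∑ t : Γ ⧸ H, ρ t.out ∘ₗ θ ∘ₗ ρ t.out⁻¹ = LinearMap.id := by
    apply Representation.IndV.hom_ext
    intro h
    ext a
    change (∑ t : Γ ⧸ H, ρ t.out ∘ₗ θ ∘ₗ ρ t.out⁻¹) (mk h a) = mk h a
    rw [LinearMap.sum_apply, Finset.sum_eq_single (QuotientGroup.mk h⁻¹)]
    · change ρ _ (θ (ρ _ (mk h a))) = _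
      rw [hρ, hθ, if_pos, hρ]
      · simp
      · rw [inv_inv]
        simpa using QuotientGroup.eq.1 (QuotientGroup.out_eq' ((h⁻¹ : Γ) : Γ ⧸ H)).symm
    · intro t _ ht
      change ρ _ (θ (ρ _ (mk h a))) = 0
      rw [hρ, hθ, if_neg, map_zero]
      intro hmem
      apply ht
      rw [← QuotientGroup.out_eq' t, eq_comm, QuotientGroup.eq]
      simpa using hmem
    · simp
  have h3 : ∀ m, ∑ t : Γ ⧸ H, ρ t.out (θ (ρ t.out⁻¹ m)) = m := fun m => by
    conv_rhs => rw [← LinearMap.id_apply (R := k) m, ← h2, LinearMap.sum_apply]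
    rfl
  refine ⟨θ, fun s hs m => ?_, fun m => ?_⟩
  · rw [Representation.single_smul, Representation.single_smul, one_smul, one_smul]
    exact LinearMap.congr_fun (h1 s hs) m
  · simp only [Representation.single_smul, one_smul]
    exact h3 m

/-- Higman's criterion. In one direction θ is transported from the induced module along i and q; in
the other, M is exhibited as a summand of the module induced from its own restriction. -/
theorem isRelativelyProjective_iff_exists_trace {M : Type*} [AddCommGroup M] [Module k[Γ] M]
    [Module k M] [IsScalarTower k k[Γ] M] (H : Subgroup Γ) [Fintype (Γ ⧸ H)] :
    IsRelativelyProjective k M H ↔ ∃ θ : M →ₗ[k] M,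
      (∀ s ∈ H, ∀ m, θ (single s (1 : k) • m) = single s (1 : k) • θ m) ∧
      ∀ m, ∑ t : Γ ⧸ H, single t.out (1 : k) • θ (single t.out⁻¹ (1 : k) • m) = m := by
  constructor
  · rintro ⟨L, _, _, σ, i, q, hqi⟩
    obtain ⟨θ, h1, h2⟩ := exists_ind_trace σ
    refine ⟨(q.restrictScalars k) ∘ₗ θ ∘ₗ (i.restrictScalars k), fun s hs m => ?_, fun m => ?_⟩
    · simp only [LinearMap.comp_apply, LinearMap.restrictScalars_apply, map_smul i, h1 s hs]
      exact map_smul q _ _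
    · have := congrArg q (h2 (i m))
      rw [show q (i m) = m from LinearMap.congr_fun hqi m, map_sum] at this
      conv_rhs => rw [← this]
      refine Finset.sum_congr rfl fun t _ => ?_
      simp only [LinearMap.comp_apply, LinearMap.restrictScalars_apply, map_smul i]
      exact (map_smul q _ _).symm
  · rintro ⟨θ, h1, h2⟩
    let ρ := Representation.ofModule' (k := k) (G := Γ) M
    have hρ : ∀ g m, ρ g m = single g (1 : k) • m := fun g m => by
      simp [ρ, Representation.ofModule']
    let σ : Representation k H M := ρ.comp H.subtype
    let mk := Representation.IndV.mk H.subtype σ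
    let τ := Representation.ind H.subtype σ
    have hτ : ∀ g h a, τ g (mk h a) = mk (h * g⁻¹) a := Representation.ind_mk H.subtype σ
    -- The component of m at the coset tH is θ(t⁻¹m). Following this by the multiplication map q₀
    -- gives the trace of θ, which is the identity.
    let i₀ : M →ₗ[k] Representation.IndV H.subtype σ :=
      ∑ t : Γ ⧸ H, mk t.out⁻¹ ∘ₗ θ ∘ₗ ρ t.out⁻¹
    have hi₀ : ∀ m, i₀ m = ∑ t : Γ ⧸ H, mk t.out⁻¹ (θ (ρ t.out⁻¹ m)) := fun m =>
      LinearMap.sum_apply _ _ _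
    let q₀ : Representation.IndV H.subtype σ →ₗ[k] M := indLift σ (fun h => ρ h⁻¹) (by
      intro s h a
      rw [show σ s a = ρ s a from rfl, ← Module.End.mul_apply, ← map_mul]
      simp)
    have hq₀ : ∀ h a, q₀ (mk h a) = ρ h⁻¹ a := indLift_mk σ _ _
    have hi : ∀ g m, i₀ (ρ g m) = τ g (i₀ m) := by
      intro g m
      rw [hi₀, hi₀, map_sum]
      have hF : ∀ x, ∀ h ∈ H, mk (x * h)⁻¹ (θ (ρ (x * h)⁻¹ (ρ g m))) =
          mk x⁻¹ (θ (ρ x⁻¹ (ρ g m))) := by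
        intro x h hh
        have h3 := h1 h⁻¹ (inv_mem hh) (ρ x⁻¹ (ρ g m))
        rw [← hρ, ← hρ] at h3
        rw [mul_inv_rev, map_mul, Module.End.mul_apply, h3]
        exact IndV_mk_mul σ ⟨h⁻¹, inv_mem hh⟩ x⁻¹ _
      rw [← sum_out_mul_left (F := fun x => mk x⁻¹ (θ (ρ x⁻¹ (ρ g m)))) hF g]
      refine Finset.sum_congr rfl fun t _ => ?_
      rw [hτ, mul_inv_rev, ← Module.End.mul_apply (ρ _), ← map_mul, inv_mul_cancel_right]
    have hq : ∀ g m, q₀ (τ g m) = ρ g (q₀ m) := by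
      intro g m
      have : q₀ ∘ₗ τ g = ρ g ∘ₗ q₀ := by
        apply Representation.IndV.hom_ext
        intro h
        ext a
        change q₀ (τ g (mk h a)) = ρ g (q₀ (mk h a))
        rw [hτ, hq₀, hq₀, mul_inv_rev, inv_inv, map_mul]
        rfl
      exact LinearMap.congr_fun this m
    have hs : ∀ g (v : τ.asModule), single g (1 : k) • v =
        τ.asModuleEquiv.symm (τ g (τ.asModuleEquiv v)) := single_one_smul_asModule τ
    let i : M →ₗ[k[Γ]] τ.asModule := MonoidAlgebra.equivariantOfLinearOfComm
      (τ.asModuleEquiv.symm.toLinearMap ∘ₗ i₀) (by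
        intro g m
        rw [hs, ← hρ]
        exact hi g m)
    let q : τ.asModule →ₗ[k[Γ]] M := MonoidAlgebra.equivariantOfLinearOfComm
      (q₀ ∘ₗ τ.asModuleEquiv.toLinearMap) (by
        intro g m
        rw [hs, ← hρ]
        exact hq g (τ.asModuleEquiv m))
    refine ⟨M, inferInstance, inferInstance, σ, i, q, ?_⟩
    ext m
    change q₀ (i₀ m) = m
    rw [hi₀, map_sum]
    simp only [hq₀, inv_inv, hρ]
    exact h2 m

/-- Extending θ by e, or compressing it by e, turns the identity of eM into e and back; the
criterion can thus be read inside End(M). -/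
theorem exists_range_trace_iff {M : Type*} [AddCommGroup M] [Module k[Γ] M]
    [Module k M] [IsScalarTower k k[Γ] M] {ι : Type*} [Fintype ι] (g : ι → Γ) (H : Set Γ)
    {e : Module.End k[Γ] M} (he : e * e = e) :
    (∃ θ : LinearMap.range e →ₗ[k] LinearMap.range e,
      (∀ s ∈ H, ∀ m, θ (single s (1 : k) • m) = single s (1 : k) • θ m) ∧
      ∀ m, ∑ i, single (g i) (1 : k) • θ (single (g i)⁻¹ (1 : k) • m) = m) ↔
    ∃ θ : M →ₗ[k] M, (∀ s ∈ H, ∀ m, θ (single s (1 : k) • m) = single s (1 : k) • θ m) ∧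
      ∀ m, ∑ i, single (g i) (1 : k) • θ (single (g i)⁻¹ (1 : k) • m) = e m := by
  have hr : ∀ w : LinearMap.range e, e.rangeRestrict w = w := fun w =>
    Subtype.ext (idem_apply_of_mem_range he w.2)
  constructor
  · rintro ⟨θ, h1, h2⟩
    refine ⟨((LinearMap.range e).subtype.restrictScalars k) ∘ₗ θ ∘ₗ
      (e.rangeRestrict.restrictScalars k), fun s hs m => ?_, fun m => ?_⟩
    · simp only [LinearMap.comp_apply, LinearMap.restrictScalars_apply, map_smul e.rangeRestrict,
        h1 s hs]
      rfl
    · have := congrArg (LinearMap.range e).subtype (h2 (e.rangeRestrict m))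
      rw [map_sum] at this
      refine Eq.trans (Finset.sum_congr rfl fun i _ => ?_) this
      simp only [LinearMap.comp_apply, LinearMap.restrictScalars_apply, map_smul e.rangeRestrict]
      rfl
  · rintro ⟨θ, h1, h2⟩
    refine ⟨(e.rangeRestrict.restrictScalars k) ∘ₗ θ ∘ₗ
      ((LinearMap.range e).subtype.restrictScalars k), fun s hs m => ?_, fun m => ?_⟩
    · change e.rangeRestrict (θ (single s (1 : k) • (m : M))) = _
      rw [h1 s hs, map_smul]
      rfl
    · have := congrArg e.rangeRestrict (h2 m)
      rw [idem_apply_of_mem_range he m.2, hr, map_sum] at this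
      refine Eq.trans (Finset.sum_congr rfl fun i _ => ?_) this
      exact (map_smul e.rangeRestrict _ _).symm

end Trace

/-! ### Higman's criterion in terms of idempotent endomorphisms -/

section RangeIdem

open MonoidAlgebra (single)

variable {k Γ V : Type*} [Field k] [Group Γ] [AddCommGroup V] [Module k V]
  (ρ : Representation k Γ V)

/-- The underlying `k`-linear map of an endomorphism of the module of a representation. -/
noncomputable def endToLin : Module.End k[Γ] ρ.asModule →ₐ[k] Module.End k V where
  toFun T := ρ.asModuleEquiv.toLinearMap ∘ₗ T.restrictScalars k ∘ₗ ρ.asModuleEquiv.symm.toLinearMap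
  map_one' := rfl
  map_mul' _ _ := rfl
  map_zero' := rfl
  map_add' _ _ := rfl
  commutes' _ := rfl

theorem endToLin_comm (T : Module.End k[Γ] ρ.asModule) (g : Γ) :
    endToLin ρ T * ρ g = ρ g * endToLin ρ T := by
  ext v
  have := T.map_smul (single g (1 : k)) (ρ.asModuleEquiv.symm v)
  rw [single_one_smul_asModule, single_one_smul_asModule] at this
  exact this

theorem exists_endToLin_eq {T : Module.End k V} (hT : ∀ g, T * ρ g = ρ g * T) :
    ∃ T' : Module.End k[Γ] ρ.asModule, endToLin ρ T' = T := by
  refine ⟨MonoidAlgebra.equivariantOfLinearOfComm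
    (ρ.asModuleEquiv.symm.toLinearMap ∘ₗ T ∘ₗ ρ.asModuleEquiv.toLinearMap) ?_, rfl⟩
  intro g v
  rw [single_one_smul_asModule, single_one_smul_asModule]
  exact LinearMap.congr_fun (hT g) (ρ.asModuleEquiv v)

theorem endToLin_injective : Function.Injective (endToLin ρ) := fun _ _ h =>
  LinearMap.ext fun v => LinearMap.congr_fun h (ρ.asModuleEquiv v)

theorem exists_asModule_trace_iff {ι : Type*} [Fintype ι] (g : ι → Γ) (H : Set Γ)
    (e : Module.End k[Γ] ρ.asModule) :
    (∃ θ : ρ.asModule →ₗ[k] ρ.asModule,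
      (∀ s ∈ H, ∀ m, θ (single s (1 : k) • m) = single s (1 : k) • θ m) ∧
      ∀ m, ∑ i, single (g i) (1 : k) • θ (single (g i)⁻¹ (1 : k) • m) = e m) ↔
    ∃ θ : Module.End k V, (∀ s ∈ H, θ * ρ s = ρ s * θ) ∧
      endToLin ρ e = ∑ i, ρ (g i) * θ * ρ (g i)⁻¹ := by
  simp only [single_one_smul_asModule]
  constructor
  · rintro ⟨θ, h1, h2⟩
    refine ⟨ρ.asModuleEquiv.toLinearMap ∘ₗ θ ∘ₗ ρ.asModuleEquiv.symm.toLinearMap,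
      fun s hs => LinearMap.ext fun v => h1 s hs (ρ.asModuleEquiv.symm v),
      LinearMap.ext fun v => ?_⟩
    rw [LinearMap.sum_apply]
    have := congrArg ρ.asModuleEquiv (h2 (ρ.asModuleEquiv.symm v))
    rw [map_sum] at this
    exact this.symm
  · rintro ⟨θ, h1, h2⟩
    refine ⟨ρ.asModuleEquiv.symm.toLinearMap ∘ₗ θ ∘ₗ ρ.asModuleEquiv.toLinearMap,
      fun s hs m => LinearMap.congr_fun (h1 s hs) (ρ.asModuleEquiv m), fun m => ?_⟩
    have := LinearMap.congr_fun h2 (ρ.asModuleEquiv m)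
    rw [LinearMap.sum_apply] at this
    have h3 := congrArg ρ.asModuleEquiv.symm this
    rw [map_sum] at h3
    exact h3.symm

theorem projective_range_iff [Fintype Γ] {e : Module.End k[Γ] ρ.asModule} (he : e * e = e) :
    Module.Projective k[Γ] (LinearMap.range e) ↔
      ∃ θ : Module.End k V, endToLin ρ e = ∑ g, ρ g * θ * ρ g⁻¹ := by
  rw [projective_iff_exists_trace (k := k)]
  -- The empty set makes the equivariance condition on θ vacuous.
  simpa using (exists_range_trace_iff (fun g : Γ => g) ∅ he).trans
    (exists_asModule_trace_iff ρ (fun g : Γ => g) ∅ e)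

theorem isRelativelyProjective_range_iff (H : Subgroup Γ) [Fintype (Γ ⧸ H)]
    {e : Module.End k[Γ] ρ.asModule} (he : e * e = e) :
    IsRelativelyProjective k (LinearMap.range e) H ↔
      ∃ θ : Module.End k V, (∀ s ∈ H, θ * ρ s = ρ s * θ) ∧
        endToLin ρ e = ∑ t : Γ ⧸ H, ρ t.out * θ * ρ t.out⁻¹ := by
  rw [isRelativelyProjective_iff_exists_trace]
  exact (exists_range_trace_iff (fun t : Γ ⧸ H => t.out) H he).trans
    (exists_asModule_trace_iff ρ (fun t : Γ ⧸ H => t.out) H e)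

end RangeIdem

/-! ### Endomorphisms of permutation modules as matrices -/

section Matrices

open MonoidAlgebra (single)

section

variable {k Γ Y : Type*} [Group Γ]

/-- The action of permutations on matrices by simultaneous permutation of rows and columns. -/
def permConj (σ : Equiv.Perm Y) (a : Matrix Y Y k) : Matrix Y Y k :=
  a.submatrix (σ⁻¹ : Equiv.Perm Y) (σ⁻¹ : Equiv.Perm Y)

theorem permConj_apply (σ : Equiv.Perm Y) (a : Matrix Y Y k) (x y : Y) :
    permConj σ a x y = a (σ⁻¹ x) (σ⁻¹ y) := rfl

theorem permConj_mul (σ τ : Equiv.Perm Y) (a : Matrix Y Y k) :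
    permConj (σ * τ) a = permConj σ (permConj τ a) := by
  ext x y
  simp [permConj_apply]

/-- The matrices which are invariant under a subgroup `H`. -/
def IsInvMat (f : Γ →* Equiv.Perm Y) (H : Subgroup Γ) (a : Matrix Y Y k) : Prop :=
  ∀ s ∈ H, permConj (f s) a = a

theorem IsInvMat.mono {f : Γ →* Equiv.Perm Y} {H K : Subgroup Γ} (hHK : H ≤ K)
    {a : Matrix Y Y k} (ha : IsInvMat f K a) : IsInvMat f H a := fun s hs => ha s (hHK hs)

end

variable {k Γ Y : Type*} [Field k] [Group Γ]

theorem permConj_smul (σ : Equiv.Perm Y) (c : k) (a : Matrix Y Y k) :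
    permConj σ (c • a) = c • permConj σ a := rfl

theorem permConj_sum {ι : Type*} (s : Finset ι) (σ : Equiv.Perm Y) (a : ι → Matrix Y Y k) :
    permConj σ (∑ i ∈ s, a i) = ∑ i ∈ s, permConj σ (a i) := by
  ext x y
  simp [permConj_apply, Matrix.sum_apply]

theorem permConj_matrix_mul [Fintype Y] (σ : Equiv.Perm Y) (a b : Matrix Y Y k) :
    permConj σ (a * b) = permConj σ a * permConj σ b :=
  (Matrix.submatrix_mul_equiv a b _ (σ⁻¹ : Equiv.Perm Y) _).symm

theorem IsInvMat.mul [Fintype Y] {f : Γ →* Equiv.Perm Y} {H : Subgroup Γ} {a b : Matrix Y Y k}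
    (ha : IsInvMat f H a) (hb : IsInvMat f H b) : IsInvMat f H (a * b) := fun s hs => by
  rw [permConj_matrix_mul, ha s hs, hb s hs]

/-- The relative trace of a matrix. -/
noncomputable def relTrace (f : Γ →* Equiv.Perm Y) (H : Subgroup Γ) [Fintype (Γ ⧸ H)]
    (a : Matrix Y Y k) : Matrix Y Y k :=
  ∑ t : Γ ⧸ H, permConj (f t.out) a

variable [Fintype Y] [DecidableEq Y]

variable (k Y) in
/-- The matrix of an endomorphism of `k[Y]` with respect to the basis `Y`. -/
noncomputable def toMat : Module.End k k[Y] ≃ₐ[k] Matrix Y Y k :=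
  LinearMap.toMatrixAlgEquiv (Module.Basis.ofRepr (MonoidAlgebra.coeffLinearEquiv k))

theorem toMat_apply (T : Module.End k k[Y]) (x y : Y) :
    toMat k Y T x y = (T (single y 1)).coeff x := by
  rw [toMat, LinearMap.toMatrixAlgEquiv_apply]
  rfl

theorem toMat_conj (σ : Equiv.Perm Y) (T : Module.End k k[Y]) :
    toMat k Y (Representation.ofMulAction k (Equiv.Perm Y) Y σ * T *
      Representation.ofMulAction k (Equiv.Perm Y) Y σ⁻¹) = permConj σ (toMat k Y T) := by
  ext x y
  rw [toMat_apply, permConj_apply, toMat_apply, Module.End.mul_apply, Module.End.mul_apply,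
    Representation.coeff_ofMulAction, Representation.ofMulAction_single]
  rfl

variable {ρ : Representation k Γ k[Y]} {f : Γ →* Equiv.Perm Y}

variable (ρ) in
/-- The matrix of an endomorphism of a permutation module. -/
noncomputable def endMat : Module.End k[Γ] ρ.asModule →ₐ[k] Matrix Y Y k :=
  (toMat k Y).toAlgHom.comp (endToLin ρ)

theorem endMat_injective : Function.Injective (endMat ρ) :=
  (toMat k Y).injective.comp (endToLin_injective ρ)

theorem isInvMat_toMat_iff (hρ : ∀ g, ρ g = Representation.ofMulAction k (Equiv.Perm Y) Y (f g))
    (H : Subgroup Γ) (T : Module.End k k[Y]) :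
    IsInvMat f H (toMat k Y T) ↔ ∀ s ∈ H, T * ρ s = ρ s * T := by
  refine forall₂_congr fun s _ => ?_
  rw [← toMat_conj, (toMat k Y).injective.eq_iff, ← map_inv, ← hρ, ← hρ]
  constructor
  · intro h
    conv_lhs => rw [← h]
    rw [mul_assoc, ← map_mul, inv_mul_cancel, map_one, mul_one]
  · intro h
    rw [← h, mul_assoc, ← map_mul, mul_inv_cancel, map_one, mul_one]

theorem isInvMat_endMat (hρ : ∀ g, ρ g = Representation.ofMulAction k (Equiv.Perm Y) Y (f g))
    (T : Module.End k[Γ] ρ.asModule) (H : Subgroup Γ) : IsInvMat f H (endMat ρ T) :=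
  (isInvMat_toMat_iff hρ H _).2 fun s _ => endToLin_comm ρ T s

theorem exists_endMat_eq (hρ : ∀ g, ρ g = Representation.ofMulAction k (Equiv.Perm Y) Y (f g))
    {a : Matrix Y Y k} (ha : IsInvMat f ⊤ a) : ∃ T, endMat ρ T = a := by
  obtain ⟨b, rfl⟩ := (toMat k Y).surjective a
  rw [isInvMat_toMat_iff hρ] at ha
  obtain ⟨T, hT⟩ := exists_endToLin_eq ρ fun g => ha g trivial
  exact ⟨T, congrArg (toMat k Y) hT⟩

theorem toMat_conj_rep (hρ : ∀ g, ρ g = Representation.ofMulAction k (Equiv.Perm Y) Y (f g))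
    (g : Γ) (T : Module.End k k[Y]) :
    toMat k Y (ρ g * T * ρ g⁻¹) = permConj (f g) (toMat k Y T) := by
  rw [hρ, hρ, map_inv, toMat_conj]

theorem projective_range_iff_endMat [Fintype Γ]
    (hρ : ∀ g, ρ g = Representation.ofMulAction k (Equiv.Perm Y) Y (f g))
    {e : Module.End k[Γ] ρ.asModule} (he : e * e = e) :
    Module.Projective k[Γ] (LinearMap.range e) ↔
      ∃ a : Matrix Y Y k, endMat ρ e = ∑ g, permConj (f g) a := by
  rw [projective_range_iff ρ he, (toMat k Y).surjective.exists]
  refine exists_congr fun θ => ?_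
  rw [← (toMat k Y).injective.eq_iff, map_sum]
  simp only [toMat_conj_rep hρ]
  rfl

theorem isRelativelyProjective_range_iff_endMat
    (hρ : ∀ g, ρ g = Representation.ofMulAction k (Equiv.Perm Y) Y (f g))
    (H : Subgroup Γ) [Fintype (Γ ⧸ H)] {e : Module.End k[Γ] ρ.asModule} (he : e * e = e) :
    IsRelativelyProjective k (LinearMap.range e) H ↔
      ∃ a : Matrix Y Y k, IsInvMat f H a ∧ endMat ρ e = relTrace f H a := by
  rw [isRelativelyProjective_range_iff ρ H he, (toMat k Y).surjective.exists]
  refine exists_congr fun θ => and_congr (isInvMat_toMat_iff hρ H θ).symm ?_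
  rw [← (toMat k Y).injective.eq_iff, map_sum]
  simp only [toMat_conj_rep hρ]
  rfl

end Matrices

/-! ### Properties of relative traces -/

section RelTrace

variable {k Γ Y : Type*} [Field k] [Group Γ] {f : Γ →* Equiv.Perm Y}

theorem permConj_mul_right_of_isInvMat {H : Subgroup Γ} {a : Matrix Y Y k} (ha : IsInvMat f H a) :
    ∀ g, ∀ h ∈ H, permConj (f (g * h)) a = permConj (f g) a := fun g h hh => by
  rw [map_mul, permConj_mul, ha h hh]

theorem isInvMat_relTrace {H : Subgroup Γ} [Fintype (Γ ⧸ H)] {a : Matrix Y Y k}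
    (ha : IsInvMat f H a) : IsInvMat f ⊤ (relTrace f H a) := fun g _ => by
  rw [relTrace, permConj_sum, ← sum_out_mul_left (F := fun x => permConj (f x) a)
    (permConj_mul_right_of_isInvMat ha) g]
  simp only [map_mul, permConj_mul]

theorem mul_relTrace [Fintype Y] {H : Subgroup Γ} [Fintype (Γ ⧸ H)] {a c : Matrix Y Y k}
    (hc : IsInvMat f ⊤ c) : c * relTrace f H a = relTrace f H (c * a) := by
  rw [relTrace, Finset.mul_sum]
  refine Finset.sum_congr rfl fun t _ => ?_
  rw [permConj_matrix_mul, hc _ trivial]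

theorem relTrace_mul [Fintype Y] {H : Subgroup Γ} [Fintype (Γ ⧸ H)] {a c : Matrix Y Y k}
    (hc : IsInvMat f ⊤ c) : relTrace f H a * c = relTrace f H (a * c) := by
  rw [relTrace, Finset.sum_mul]
  refine Finset.sum_congr rfl fun t _ => ?_
  rw [permConj_matrix_mul, hc _ trivial]

theorem mul_sum_permConj [Fintype Y] [Fintype Γ] {a c : Matrix Y Y k}
    (hc : IsInvMat f ⊤ c) : c * ∑ g, permConj (f g) a = ∑ g, permConj (f g) (c * a) := by
  rw [Finset.mul_sum]
  refine Finset.sum_congr rfl fun t _ => ?_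
  rw [permConj_matrix_mul, hc _ trivial]

theorem sum_permConj_mul [Fintype Y] [Fintype Γ] {a c : Matrix Y Y k}
    (hc : IsInvMat f ⊤ c) : (∑ g, permConj (f g) a) * c = ∑ g, permConj (f g) (a * c) := by
  rw [Finset.sum_mul]
  refine Finset.sum_congr rfl fun t _ => ?_
  rw [permConj_matrix_mul, hc _ trivial]

theorem relTrace_sum {ι : Type*} (s : Finset ι) {H : Subgroup Γ} [Fintype (Γ ⧸ H)]
    (a : ι → Matrix Y Y k) : relTrace f H (∑ i ∈ s, a i) = ∑ i ∈ s, relTrace f H (a i) := by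
  simp only [relTrace, permConj_sum]
  exact Finset.sum_comm

theorem relTrace_smul {H : Subgroup Γ} [Fintype (Γ ⧸ H)] (c : k) (a : Matrix Y Y k) :
    relTrace f H (c • a) = c • relTrace f H a := by
  simp only [relTrace, permConj_smul, Finset.smul_sum]

/-- Transitivity of the relative trace. -/
theorem relTrace_relTrace {H K : Subgroup Γ} (hHK : H ≤ K) [Fintype (Γ ⧸ H)] [Fintype (Γ ⧸ K)]
    [Fintype (K ⧸ H.subgroupOf K)] {a : Matrix Y Y k} (ha : IsInvMat f H a) :
    relTrace f K (relTrace (f.comp K.subtype) (H.subgroupOf K) a) = relTrace f H a := by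
  simp only [relTrace, permConj_sum]
  rw [← Fintype.sum_prod_type']
  refine Fintype.sum_equiv (Subgroup.quotientEquivProdOfLE hHK).symm _ _ fun x => ?_
  obtain ⟨t, s⟩ := x
  induction s using QuotientGroup.induction_on with
  | _ s =>
  have h1 := permConj_mul_right_of_isInvMat ha
  have ha' : IsInvMat (f.comp K.subtype) (H.subgroupOf K) a := fun s hs => ha s hs
  have h2 : (Subgroup.quotientEquivProdOfLE hHK).symm (t, (s : K ⧸ H.subgroupOf K)) =
      ((t.out * s : Γ) : Γ ⧸ H) := rfl
  rw [h2, apply_out_mk (F := fun x => permConj (f x) a) h1,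
    apply_out_mk (F := fun x => permConj (f.comp K.subtype x) a)
      (permConj_mul_right_of_isInvMat ha'), map_mul, permConj_mul]
  rfl

/-- By transitivity, since the trace from H to K of a K-invariant matrix is multiplication by the
index. -/
theorem relTrace_of_le [Finite Γ] {H K : Subgroup Γ} (hHK : H ≤ K) [Fintype (Γ ⧸ H)]
    [Fintype (Γ ⧸ K)] {a : Matrix Y Y k} (ha : IsInvMat f K a) :
    relTrace f H a = (H.relIndex K : k) • relTrace f K a := by
  have := Fintype.ofFinite (K ⧸ H.subgroupOf K)
  rw [← relTrace_relTrace hHK (ha.mono hHK), ← relTrace_smul]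
  congr 1
  have hc : ∀ t : K ⧸ H.subgroupOf K, permConj (f.comp K.subtype t.out) a = a := fun t =>
    ha _ t.out.2
  simp only [relTrace, hc]
  rw [Finset.sum_const, Finset.card_univ, ← Nat.card_eq_fintype_card, Nat.cast_smul_eq_nsmul]
  rfl

/-- The relative trace from a conjugate subgroup. -/
theorem relTrace_map_conj {H : Subgroup Γ} (g : Γ) [Fintype (Γ ⧸ H)]
    [Fintype (Γ ⧸ H.map (MulAut.conj g).toMonoidHom)] {a : Matrix Y Y k} (ha : IsInvMat f H a) :
    IsInvMat f (H.map (MulAut.conj g).toMonoidHom) (permConj (f g) a) ∧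
    relTrace f (H.map (MulAut.conj g).toMonoidHom) (permConj (f g) a) = relTrace f H a := by
  have hinv : IsInvMat f (H.map (MulAut.conj g).toMonoidHom) (permConj (f g) a) := by
    rintro _ ⟨h, hh, rfl⟩
    rw [← permConj_mul, ← map_mul]
    change permConj (f (g * h * g⁻¹ * g)) a = _
    rw [inv_mul_cancel_right, map_mul, permConj_mul, ha h hh]
  refine ⟨hinv, ?_⟩
  symm
  have hmem : ∀ h, g * h * g⁻¹ ∈ H.map (MulAut.conj g).toMonoidHom ↔ h ∈ H := by
    intro h
    refine ⟨?_, fun hh => ⟨h, hh, rfl⟩⟩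
    rintro ⟨h', hh', he⟩
    have : g * h' * g⁻¹ = g * h * g⁻¹ := he
    rwa [← mul_left_cancel (mul_right_cancel this)]
  -- The coset tH goes to tg⁻¹(gHg⁻¹) = tHg⁻¹.
  refine Fintype.sum_bijective
    (fun t : Γ ⧸ H => ((t.out * g⁻¹ : Γ) : Γ ⧸ H.map (MulAut.conj g).toMonoidHom))
    ⟨fun t u htu => ?_, fun u => ⟨((u.out * g : Γ) : Γ ⧸ H), ?_⟩⟩ _ _ fun t => ?_
  · rw [QuotientGroup.eq] at htu
    rw [← QuotientGroup.out_eq' t, ← QuotientGroup.out_eq' u, QuotientGroup.eq, ← hmem]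
    convert htu using 1
    group
  · conv_rhs => rw [← QuotientGroup.out_eq' u]
    have h1 := QuotientGroup.eq.1 (QuotientGroup.out_eq' ((u.out * g : Γ) : Γ ⧸ H))
    rw [QuotientGroup.eq]
    rw [← hmem] at h1
    convert h1 using 1
    group
  · rw [apply_out_mk (F := fun x => permConj (f x) (permConj (f g) a))
      (permConj_mul_right_of_isInvMat hinv), ← permConj_mul, ← map_mul, inv_mul_cancel_right]

end RelTrace

/-! ### Matrices that are traces from a subgroup -/

section Trace

variable {k Γ Y : Type*} [Field k] [Group Γ]

/-- The matrix `m` is a relative trace of an `H`-invariant matrix. -/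
def IsTrace (f : Γ →* Equiv.Perm Y) (H : Subgroup Γ) (m : Matrix Y Y k) : Prop :=
  ∃ _ : Fintype (Γ ⧸ H), ∃ a, IsInvMat f H a ∧ m = relTrace f H a

variable {f : Γ →* Equiv.Perm Y} {H : Subgroup Γ} {m : Matrix Y Y k}

theorem IsTrace.isInvMat (hm : IsTrace f H m) : IsInvMat f ⊤ m := by
  obtain ⟨_, a, ha, rfl⟩ := hm
  exact isInvMat_relTrace ha

theorem IsTrace.mul_left [Fintype Y] (hm : IsTrace f H m) {c : Matrix Y Y k}
    (hc : IsInvMat f ⊤ c) : IsTrace f H (c * m) := by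
  obtain ⟨_, a, ha, rfl⟩ := hm
  exact ⟨_, c * a, (hc.mono le_top).mul ha, mul_relTrace hc⟩

theorem IsTrace.mul_right [Fintype Y] (hm : IsTrace f H m) {c : Matrix Y Y k}
    (hc : IsInvMat f ⊤ c) : IsTrace f H (m * c) := by
  obtain ⟨_, a, ha, rfl⟩ := hm
  exact ⟨_, a * c, ha.mul (hc.mono le_top), relTrace_mul hc⟩

theorem IsTrace.smul (hm : IsTrace f H m) (c : k) : IsTrace f H (c • m) := by
  obtain ⟨_, a, ha, rfl⟩ := hm
  refine ⟨_, c • a, fun s hs => ?_, (relTrace_smul c a).symm⟩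
  rw [permConj_smul, ha s hs]

theorem IsTrace.map_conj [Finite Γ] (hm : IsTrace f H m) (g : Γ) :
    IsTrace f (H.map (MulAut.conj g).toMonoidHom) m := by
  obtain ⟨_, a, ha, rfl⟩ := hm
  obtain ⟨h1, h2⟩ := @relTrace_map_conj _ _ _ _ _ f H g _ (Fintype.ofFinite _) a ha
  exact ⟨_, _, h1, h2.symm⟩

theorem IsTrace.of_relIndex [Finite Γ] {K : Subgroup Γ} (hm : IsTrace f K m) (hHK : H ≤ K)
    (h0 : (H.relIndex K : k) ≠ 0) : IsTrace f H m := by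
  obtain ⟨_, a, ha, rfl⟩ := hm
  have := Fintype.ofFinite (Γ ⧸ H)
  have h1 : IsTrace f H (relTrace f H a) := ⟨_, a, ha.mono hHK, rfl⟩
  have h2 := h1.smul (H.relIndex K : k)⁻¹
  rwa [relTrace_of_le hHK ha, smul_smul, inv_mul_cancel₀ h0, one_smul] at h2

theorem isRelativelyProjective_range_iff_isTrace [Finite Γ] [Fintype Y] [DecidableEq Y]
    {ρ : Representation k Γ k[Y]}
    (hρ : ∀ g, ρ g = Representation.ofMulAction k (Equiv.Perm Y) Y (f g))
    {e : Module.End k[Γ] ρ.asModule} (he : e * e = e) :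
    IsRelativelyProjective k (LinearMap.range e) H ↔ IsTrace f H (endMat ρ e) := by
  constructor
  · intro h
    have := Fintype.ofFinite (Γ ⧸ H)
    exact ⟨_, (isRelativelyProjective_range_iff_endMat hρ H he).1 h⟩
  · rintro ⟨_, h⟩
    exact (isRelativelyProjective_range_iff_endMat hρ H he).2 h

end Trace

/-! ### The Brauer homomorphism -/

/-- A nontrivial orbit of a p-group has length divisible by p, and h is constant on it. -/
theorem sum_eq_sum_fixedPoints {p : ℕ} [Fact p.Prime] {k : Type*} [Ring k] [CharP k p]
    {Q : Type*} [Group Q] (hQ : IsPGroup p Q) {T : Type*} [MulAction Q T] [Fintype T]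
    [DecidablePred (· ∈ MulAction.fixedPoints Q T)] {h : T → k} (hh : ∀ (q : Q) t, h (q • t) = h t) :
    ∑ t, h t = ∑ t with t ∈ MulAction.fixedPoints Q T, h t := by
  classical
  -- Sorting by the value of h gives Q-stable level sets, to each of which the congruence between
  -- cardinality and number of fixed points applies.
  rw [← Finset.sum_fiberwise_of_maps_to (t := Finset.univ.image h)
      (fun t _ => Finset.mem_image_of_mem h (Finset.mem_univ t)),
    ← Finset.sum_fiberwise_of_maps_to (t := Finset.univ.image h) (g := h)
      (s := Finset.univ.filter (· ∈ MulAction.fixedPoints Q T))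
      (fun t _ => Finset.mem_image_of_mem h (Finset.mem_univ t))]
  refine Finset.sum_congr rfl fun c _ => ?_
  rw [Finset.sum_congr rfl fun t ht => (Finset.mem_filter.1 ht).2,
    Finset.sum_congr rfl fun t ht => (Finset.mem_filter.1 ht).2, Finset.sum_const,
    Finset.sum_const, nsmul_eq_mul, nsmul_eq_mul]
  congr 1
  rw [CharP.natCast_eq_natCast k p]
  let S : SubMulAction Q T := ⟨{t | h t = c}, fun q t ht => (hh q t).trans ht⟩
  have key := hQ.card_modEq_card_fixedPoints S
  have h1 : (Finset.univ.filter (fun t => h t = c)).card = Nat.card S := by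
    rw [← Fintype.card_subtype, ← Nat.card_eq_fintype_card]
    rfl
  have h2 : ((Finset.univ.filter (· ∈ MulAction.fixedPoints Q T)).filter (fun t => h t = c)).card =
      Nat.card (MulAction.fixedPoints Q S) := by
    rw [Finset.filter_filter, ← Fintype.card_subtype, ← Nat.card_eq_fintype_card]
    refine Nat.card_congr ⟨fun t => ⟨⟨t.1, t.2.2⟩, fun q => Subtype.ext (t.2.1 q)⟩,
      fun t => ⟨t.1.1, fun q => congrArg Subtype.val (t.2 q), t.1.2⟩, fun _ => rfl, fun _ => rfl⟩
  rw [h1, h2]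
  exact key

section Brauer

variable {p : ℕ} [Fact p.Prime] {k G Ω : Type*} [Field k] [CharP k p] [Group G]
  [MulAction G Ω] {X : Set Ω}

/-- The restriction of a matrix to a subset. -/
def compress (X : Set Ω) (a : Matrix Ω Ω k) : Matrix X X k :=
  a.submatrix (↑) (↑)

theorem isInvMat_apply {H : Subgroup G} {a : Matrix Ω Ω k}
    (ha : IsInvMat (MulAction.toPermHom G Ω) H a) {s : G} (hs : s ∈ H) (x y : Ω) :
    a (s • x) (s • y) = a x y := by
  conv_lhs => rw [← ha s hs]
  simp [permConj_apply]

/-- For x and y fixed by Q the summand a(x,z)b(z,y) is Q-invariant in z, so only the fixed points z,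
that is z in X, survive. -/
theorem compress_mul [Fintype Ω] [Fintype X] {Q : Subgroup G} (hQ : IsPGroup p Q)
    (hX : MulAction.fixedPoints Q Ω = X)
    {a b : Matrix Ω Ω k} (ha : IsInvMat (MulAction.toPermHom G Ω) Q a)
    (hb : IsInvMat (MulAction.toPermHom G Ω) Q b) :
    compress X (a * b) = compress X a * compress X b := by
  classical
  ext x y
  have hfix : ∀ (q : Q) (x : X), (q : G) • (x : Ω) = x := fun q x =>
    hX.ge x.2 q
  change (a * b) x y = _
  rw [Matrix.mul_apply, sum_eq_sum_fixedPoints (p := p) (Q := Q) hQ, Matrix.mul_apply]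
  · refine (Finset.sum_subtype _ (fun z => ?_) _)
    rw [hX]
    simp
  · intro q z
    have h1 := isInvMat_apply ha q.2 x z
    have h2 := isInvMat_apply hb q.2 z y
    rw [hfix] at h1 h2
    change a x ((q : G) • z) * b ((q : G) • z) y = _
    rw [h1, h2]

theorem relTrace_apply_fixedPoints {Q : Subgroup G} (hQ : IsPGroup p Q)
    {R : Subgroup G} [Fintype (G ⧸ R)] [DecidablePred (· ∈ MulAction.fixedPoints Q (G ⧸ R))]
    {a : Matrix Ω Ω k} (ha : IsInvMat (MulAction.toPermHom G Ω) R a)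
    {x y : Ω} (hx : x ∈ MulAction.fixedPoints Q Ω) (hy : y ∈ MulAction.fixedPoints Q Ω) :
    relTrace (MulAction.toPermHom G Ω) R a x y =
      ∑ t : G ⧸ R with t ∈ MulAction.fixedPoints Q (G ⧸ R),
        a ((t.out)⁻¹ • x) ((t.out)⁻¹ • y) := by
  rw [relTrace, Matrix.sum_apply, sum_eq_sum_fixedPoints (p := p) (Q := Q) hQ]
  · rfl
  · intro q t
    have h1 : ∀ g, ∀ r ∈ R, a ((g * r)⁻¹ • x) ((g * r)⁻¹ • y) = a (g⁻¹ • x) (g⁻¹ • y) := by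
      intro g r hr
      simpa [mul_smul] using isInvMat_apply ha (inv_mem hr) (g⁻¹ • x) (g⁻¹ • y)
    change a ((q • t).out⁻¹ • x) ((q • t).out⁻¹ • y) = a (t.out⁻¹ • x) (t.out⁻¹ • y)
    have h2 : q • t = (((q : G) * t.out : G) : G ⧸ R) := by
      conv_lhs => rw [← QuotientGroup.out_eq' t]
      rfl
    rw [h2, apply_out_mk (F := fun g => a (g⁻¹ • x) (g⁻¹ • y)) h1]
    have hx' : (q : G)⁻¹ • x = x := hx q⁻¹
    have hy' : (q : G)⁻¹ • y = y := hy q⁻¹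
    rw [mul_inv_rev, mul_smul, mul_smul, hx', hy']

theorem conj_mem_of_mem_fixedPoints {Q R : Subgroup G} {t : G ⧸ R}
    (ht : t ∈ MulAction.fixedPoints Q (G ⧸ R)) {q : G} (hq : q ∈ Q) :
    t.out⁻¹ * q * t.out ∈ R := by
  have h1 : ((q * t.out : G) : G ⧸ R) = t := by
    have := ht ⟨q, hq⟩
    rw [← QuotientGroup.out_eq' t] at this
    exact this.trans (QuotientGroup.out_eq' t)
  rw [mul_assoc]
  exact QuotientGroup.eq.1 ((QuotientGroup.out_eq' t).trans h1.symm)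

/-- Only cosets tR fixed by Q contribute to entries at fixed points of Q, and such a coset gives
t⁻¹Qt ≤ R. -/
theorem IsTrace.card_le [Finite G] {Q : Subgroup G} (hQ : IsPGroup p Q)
    (hX : MulAction.fixedPoints Q Ω = X) {R : Subgroup G} {m : Matrix Ω Ω k}
    (hm : IsTrace (MulAction.toPermHom G Ω) R m) (h0 : compress X m ≠ 0) :
    Nat.card Q ≤ Nat.card R := by
  classical
  obtain ⟨_, a, ha, rfl⟩ := hm
  by_contra hcard
  apply h0
  ext x y
  change relTrace _ R a x y = 0
  rw [relTrace_apply_fixedPoints hQ ha (hX.ge x.2) (hX.ge y.2)]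
  refine Finset.sum_eq_zero fun t ht => (hcard ?_).elim
  refine Nat.card_le_card_of_injective
    (fun q : Q => (⟨_, conj_mem_of_mem_fixedPoints (Finset.mem_filter.1 ht).2 q.2⟩ : R))
    fun q q' h => ?_
  have := congrArg Subtype.val h
  simpa using this

end Brauer

/-! ### The kernel of the Brauer homomorphism -/

section Kernel

universe w

variable {k G : Type*} {Ω : Type w} [Field k] [Group G] [MulAction G Ω]

/-- The translates of an elementary matrix by cosets of its stabilizer run once through the orbit.
These orbit indicators are used to expand an R-invariant matrix. -/
theorem relTrace_single [DecidableEq Ω] {R : Subgroup G} {K : Subgroup R} [Fintype (R ⧸ K)]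
    (z : Ω × Ω) (hK : ∀ s : R, s ∈ K ↔ s • z = z)
    [DecidablePred (· ∈ MulAction.orbit R z)] (x y : Ω) :
    relTrace ((MulAction.toPermHom G Ω).comp R.subtype) K (Matrix.single z.1 z.2 (1 : k)) x y =
      if (x, y) ∈ MulAction.orbit R z then 1 else 0 := by
  have hentry : ∀ s : R, permConj ((MulAction.toPermHom G Ω).comp R.subtype s)
      (Matrix.single z.1 z.2 (1 : k)) x y = if s • z = (x, y) then 1 else 0 := by
    intro s
    rw [permConj_apply, Matrix.single_apply]
    refine if_congr ?_ rfl rfl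
    rw [Prod.ext_iff]
    exact and_congr (eq_inv_smul_iff (g := (s : G))) (eq_inv_smul_iff (g := (s : G)))
  rw [relTrace, Matrix.sum_apply]
  simp only [hentry]
  split_ifs with h
  · obtain ⟨r, hr⟩ := h
    have hr' : r • z = (x, y) := hr
    rw [Finset.sum_eq_single (r : R ⧸ K)]
    · rw [if_pos]
      have h1 := (hK _).1 (QuotientGroup.eq.1 (QuotientGroup.out_eq' (r : R ⧸ K)))
      rw [mul_smul, inv_smul_eq_iff, hr'] at h1
      exact h1.symm
    · intro t _ ht
      rw [if_neg]
      intro h1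
      apply ht
      rw [← QuotientGroup.out_eq' t, QuotientGroup.eq, hK, mul_smul, inv_smul_eq_iff, h1, hr']
    · simp
  · refine Finset.sum_eq_zero fun t _ => if_neg fun h1 => h ⟨t.out, h1⟩

/-- An `R`-invariant matrix which vanishes on the fixed points of `R` is a sum of traces from proper
subgroups. -/
theorem exists_sum_isTrace_of_compress_eq_zero [Finite G] [Finite Ω] {R : Subgroup G}
    {X : Set Ω} (hX : MulAction.fixedPoints R Ω = X) [Fintype (G ⧸ R)] {b : Matrix Ω Ω k}
    (hb : IsInvMat (MulAction.toPermHom G Ω) R b) (h0 : compress X b = 0) :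
    ∃ (ι : Type w) (_ : Fintype ι) (m : ι → Matrix Ω Ω k),
      relTrace (MulAction.toPermHom G Ω) R b = ∑ i, m i ∧
      ∀ i, m i = 0 ∨ ∃ H < R, IsTrace (MulAction.toPermHom G Ω) H (m i) := by
  classical
  have := Fintype.ofFinite (MulAction.orbitRel.Quotient R (Ω × Ω))
  have hinst' : ∀ H : Subgroup R, Fintype (R ⧸ H) := fun H => Fintype.ofFinite _
  let z : MulAction.orbitRel.Quotient R (Ω × Ω) → Ω × Ω := fun o => o.out
  let H : Ω × Ω → Subgroup G := fun z => MulAction.stabilizer G z ⊓ R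
  have hinst : ∀ z, Fintype (G ⧸ H z) := fun z => Fintype.ofFinite _
  let E : Ω × Ω → Matrix Ω Ω k := fun z => Matrix.single z.1 z.2 1
  have hE : ∀ z, IsInvMat (MulAction.toPermHom G Ω) (H z) (E z) := by
    intro z s hs
    have hz : s • z = z := hs.1
    ext x y
    rw [permConj_apply]
    simp only [E, Matrix.single_apply]
    refine if_congr (and_congr ?_ ?_) rfl rfl
    · refine (eq_inv_smul_iff (g := s)).trans ?_
      rw [show s • z.1 = z.1 from congrArg Prod.fst hz]
    · refine (eq_inv_smul_iff (g := s)).trans ?_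
      rw [show s • z.2 = z.2 from congrArg Prod.snd hz]
  have hbz : b = ∑ o, b (z o).1 (z o).2 •
      relTrace ((MulAction.toPermHom G Ω).comp R.subtype) ((H (z o)).subgroupOf R) (E (z o)) := by
    ext x y
    have hK : ∀ o (s : R), s ∈ (H (z o)).subgroupOf R ↔ s • z o = z o := fun o s =>
      ⟨fun hs => hs.1, fun hs => ⟨hs, s.2⟩⟩
    rw [Matrix.sum_apply, Finset.sum_eq_single (Quotient.mk _ (x, y))]
    · obtain ⟨r, hr⟩ := Quotient.exact
        (Quotient.out_eq (Quotient.mk (MulAction.orbitRel R (Ω × Ω)) (x, y)))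
      have hr' : (r • x, r • y) = z (Quotient.mk _ (x, y)) := hr
      rw [Matrix.smul_apply, relTrace_single _ (hK _), if_pos, ← hr', smul_eq_mul, mul_one]
      · exact (isInvMat_apply hb r.2 x y).symm
      · rw [← hr']
        exact ⟨r⁻¹, inv_smul_smul r (x, y)⟩
    · intro o _ ho
      rw [Matrix.smul_apply, relTrace_single _ (hK _), if_neg, smul_zero]
      intro h
      apply ho
      rw [← Quotient.out_eq o]
      exact (Quotient.sound h).symm
    · simp
  refine ⟨MulAction.orbitRel.Quotient R (Ω × Ω), inferInstance, fun o => b (z o).1 (z o).2 •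
    relTrace (MulAction.toPermHom G Ω) (H (z o)) (E (z o)), ?_, fun o => ?_⟩
  · conv_lhs => rw [hbz]
    rw [relTrace_sum]
    refine Finset.sum_congr rfl fun o _ => ?_
    rw [relTrace_smul, relTrace_relTrace (inf_le_right : H (z o) ≤ R) (hE (z o))]
  -- If all of R stabilizes the pair, both its points are fixed by R, so the coefficient of this
  -- orbit is an entry of the vanishing restriction to X.
  · by_cases hlt : H (z o) < R
    · exact Or.inr ⟨_, hlt, IsTrace.smul ⟨_, _, hE _, rfl⟩ _⟩
    · left
      have hRH : R ≤ H (z o) := by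
        by_contra h
        exact hlt (lt_of_le_not_ge inf_le_right h)
      have h1 : ∀ r ∈ R, r • z o = z o := fun r hr => (hRH hr).1
      have hx : (z o).1 ∈ X := by
        rw [← hX]
        exact fun r => congrArg Prod.fst (h1 r r.2)
      have hy : (z o).2 ∈ X := by
        rw [← hX]
        exact fun r => congrArg Prod.snd (h1 r r.2)
      have h2 : b (z o).1 (z o).2 = 0 := congrFun (congrFun h0 ⟨_, hx⟩) ⟨_, hy⟩
      exact (congrArg (· • _) h2).trans (zero_smul _ _)

end Kernel

/-! ### Vertices of components of permutation modules -/

section Vertex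

variable {p : ℕ} [Fact p.Prime] {k G Ω : Type*} [Field k] [CharP k p] [Group G] [MulAction G Ω]

theorem ofMulAction_eq_toPermHom (g : G) : Representation.ofMulAction k G Ω g =
    Representation.ofMulAction k (Equiv.Perm Ω) Ω (MulAction.toPermHom G Ω g) := rfl

theorem sylowSub_smul {X : Set Ω} (s : pointStab G X) (P : Sylow p (pointStab G X)) :
    sylowSub (s • P) = (sylowSub P).map (MulAut.conj (s : G)).toMonoidHom := by
  have h : ((s • P : Sylow p (pointStab G X)) : Subgroup (pointStab G X)) =
      (P : Subgroup (pointStab G X)).map (MulAut.conj s).toMonoidHom := rfl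
  rw [sylowSub, h, Subgroup.map_map, Subgroup.map_map]
  rfl

theorem not_dvd_relIndex_sylow [Finite G] {R : Subgroup G} (P : Sylow p R) :
    ¬ p ∣ ((P : Subgroup R).map R.subtype).relIndex R := by
  rw [Subgroup.relIndex, Subgroup.subgroupOf, Subgroup.comap_map_eq_self_of_injective
    R.subtype_injective]
  exact P.not_dvd_index

variable [Finite G] [Fintype Ω] [DecidableEq Ω] {X : Set Ω}
  {e : Module.End k[G] (Representation.ofMulAction k G Ω).asModule}

theorem isVertex_iff (he : e * e = e) (R : Subgroup G) :
    IsVertex k (LinearMap.range e) R ↔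
      Minimal (fun H => IsTrace (MulAction.toPermHom G Ω) H (endMat _ e)) R := by
  have : IsRelativelyProjective k (LinearMap.range e) =
      fun H => IsTrace (MulAction.toPermHom G Ω) H (endMat _ e) :=
    funext fun H => propext (isRelativelyProjective_range_iff_isTrace ofMulAction_eq_toPermHom he)
  rw [IsVertex, this]

/-- A Sylow p-subgroup of R has index invertible in k, so a trace from R is already one from it;
minimality makes it all of R. -/
theorem isPGroup_of_isVertex (he : e * e = e) {R : Subgroup G}
    (hR : IsVertex k (LinearMap.range e) R) : IsPGroup p R := by
  rw [isVertex_iff he] at hR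
  let P : Sylow p R := default
  have hP : (P : Subgroup R).map R.subtype ≤ R := Subgroup.map_subtype_le _
  have h1 := hR.2 (hR.1.of_relIndex hP (by
    rw [Ne, CharP.cast_eq_zero_iff k p]
    exact not_dvd_relIndex_sylow P)) hP
  exact (P.2.map R.subtype).to_le h1

/-- If the restriction vanished, e would be a sum of traces from proper subgroups of R. Being
primitive, e would then itself be a trace from one of them, against minimality of R. -/
theorem compress_ne_zero_of_isVertex (p : ℕ) [Fact p.Prime] [CharP k p]
    (he : IsPrimIdem e) {R : Subgroup G}
    (hR : IsVertex k (LinearMap.range e) R) (hX : MulAction.fixedPoints R Ω = X) :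
    compress X (endMat _ e) ≠ 0 := by
  classical
  intro h0
  have hRp : IsPGroup p R := isPGroup_of_isVertex (p := p) he.idem hR
  rw [isVertex_iff he.idem] at hR
  obtain ⟨_, a, ha, hea⟩ := hR.1
  have hinv := isInvMat_endMat ofMulAction_eq_toPermHom e
  -- Replacing a by ae is what transfers the vanishing on X from the trace e to the matrix that is
  -- being traced.
  have hsum : endMat _ e = relTrace (MulAction.toPermHom G Ω) R (a * endMat _ e) := by
    rw [← relTrace_mul (hinv ⊤), ← hea, ← map_mul, he.idem]
  obtain ⟨ι, _, m, hm, hmH⟩ := exists_sum_isTrace_of_compress_eq_zero hX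
    (ha.mul (hinv R)) (by rw [compress_mul (p := p) hRp hX ha (hinv R), h0, mul_zero])
  have hmT : ∀ i, ∃ T, endMat (Representation.ofMulAction k G Ω) T = m i := fun i => by
    apply exists_endMat_eq ofMulAction_eq_toPermHom
    rcases hmH i with h | ⟨H, -, h⟩
    · rw [h]
      exact fun _ _ => rfl
    · exact h.isInvMat
  choose T hT using hmT
  obtain ⟨i, -, c, hc⟩ := he.exists_of_sum_eq k Finset.univ T (endMat_injective (by
    rw [map_sum, hsum, hm]
    simp only [hT]))
  rcases hmH i with h | ⟨H, hHR, h⟩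
  · have : T i = 0 := endMat_injective (by rw [hT, h, map_zero])
    rw [this, mul_zero, zero_mul] at hc
    exact he.ne_zero hc.symm
  · have h2 : IsTrace (MulAction.toPermHom G Ω) H
        (endMat (Representation.ofMulAction k G Ω) (e * c * T i * e)) := by
      rw [map_mul, map_mul, hT]
      exact (h.mul_left (isInvMat_endMat ofMulAction_eq_toPermHom _ ⊤)).mul_right (hinv ⊤)
    rw [hc] at h2
    exact hHR.not_ge (hR.2 h2 hHR.le)

/-- A vertex R with fixed point set X lies in some Sylow subgroup of S_X, and `IsTrace.card_le`
forces equality; Sylow subgroups are conjugate. Conversely the same bound shows that no proper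
subgroup of Q_X suffices, which makes Q_X a vertex. -/
theorem admitsFixedPointSet_range_iff (hX : IsClosedSet p G X) (Q : Sylow p (pointStab G X))
    (he : IsPrimIdem e) : AdmitsFixedPointSet k G X (LinearMap.range e) ↔
      IsTrace (MulAction.toPermHom G Ω) (sylowSub Q) (endMat _ e) ∧
        compress X (endMat _ e) ≠ 0 := by
  have hSp : ∀ P : Sylow p (pointStab G X), IsPGroup p (sylowSub P) := fun P => P.2.map _
  constructor
  · rintro ⟨R, hR, hRX⟩
    have h0 := compress_ne_zero_of_isVertex p he hR hRX
    refine ⟨?_, h0⟩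
    have hRp : IsPGroup p R := isPGroup_of_isVertex (p := p) he.idem hR
    rw [isVertex_iff he.idem] at hR
    have hRS : R ≤ pointStab G X := by
      intro r hr
      rw [mem_fixingSubgroup_iff]
      intro x hx
      exact hRX.ge hx ⟨r, hr⟩
    obtain ⟨P, hP⟩ := (hRp.comap_subtype (K := pointStab G X)).exists_le_sylow
    have hRP : R ≤ sylowSub P := by
      intro r hr
      exact ⟨⟨r, hRS hr⟩, hP hr, rfl⟩
    have hcard := hR.1.card_le (hSp P) (hX.fixedPoints_eq P) h0
    have hRP' : R = sylowSub P := Subgroup.eq_of_le_of_card_ge hRP hcard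
    obtain ⟨s, rfl⟩ := MulAction.exists_smul_eq (pointStab G X) P Q
    have h3 := hR.1.map_conj (s : G)
    rwa [hRP', ← sylowSub_smul] at h3
  · rintro ⟨htr, h0⟩
    refine ⟨sylowSub Q, (isVertex_iff he.idem _).2 ⟨htr, fun H hH hHQ => ?_⟩, hX.fixedPoints_eq Q⟩
    exact (Subgroup.eq_of_le_of_card_ge hHQ
      (hH.card_le (hSp Q) (hX.fixedPoints_eq Q) h0)).ge

end Vertex

/-! ### Comparison of N_G(Q_X)/Q_X with M_X -/

theorem sum_comp_surjective {Γ Γ' M : Type*} [Group Γ] [Group Γ'] [Fintype Γ] [Fintype Γ']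
    [AddCommMonoid M] (π : Γ' →* Γ) (hπ : Function.Surjective π) (c : Γ → M) :
    ∑ n, c (π n) = Nat.card π.ker • ∑ m, c m := by
  classical
  rw [← Finset.sum_fiberwise_of_maps_to (t := Finset.univ) (g := π) (fun _ _ => Finset.mem_univ _),
    Finset.smul_sum]
  refine Finset.sum_congr rfl fun m _ => ?_
  rw [Finset.sum_congr rfl fun n hn => by rw [(Finset.mem_filter.1 hn).2], Finset.sum_const]
  congr 1
  rw [MonoidHom.card_fiber_eq_of_mem_range π (hπ m) ⟨1, map_one π⟩, ← Fintype.card_subtype,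
    ← Nat.card_eq_fintype_card]
  rfl

theorem exists_algHom_of_injective {k E E' M : Type*} [CommSemiring k] [Semiring E] [Semiring E']
    [Semiring M] [Algebra k E] [Algebra k E'] [Algebra k M] {ι : E' →ₐ[k] M}
    (hι : Function.Injective ι) (g : E →ₐ[k] M) (h : ∀ T, ∃ T', ι T' = g T) :
    ∃ φ : E →ₐ[k] E', ∀ T, ι (φ T) = g T := by
  choose φ hφ using h
  exact ⟨{ toFun := φ
           map_one' := hι (by simp [hφ])
           map_mul' := fun _ _ => hι (by simp [hφ])
           map_zero' := hι (by simp [hφ])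
           map_add' := fun _ _ => hι (by simp [hφ])
           commutes' := fun _ => hι (by simp [hφ]) }, hφ⟩

theorem exists_algEquiv_of_surjective {k Γ Γ' V : Type*} [Field k] [Group Γ] [Group Γ']
    [AddCommGroup V] [Module k V] {ρ : Representation k Γ V} {ρ' : Representation k Γ' V}
    {π : Γ' →* Γ} (hπ : Function.Surjective π) (h : ∀ n, ρ' n = ρ (π n)) :
    ∃ φ : Module.End k[Γ] ρ.asModule ≃ₐ[k] Module.End k[Γ'] ρ'.asModule,
      ∀ T, endToLin ρ' (φ T) = endToLin ρ T := by
  obtain ⟨φ, hφ⟩ := exists_algHom_of_injective (endToLin_injective ρ') (endToLin ρ) fun T =>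
    exists_endToLin_eq ρ' fun n => by rw [h, endToLin_comm]
  refine ⟨AlgEquiv.ofBijective φ ⟨fun S T hST => ?_, fun T' => ?_⟩, hφ⟩
  · apply endToLin_injective ρ
    rw [← hφ, hST, hφ]
  · obtain ⟨T, hT⟩ := exists_endToLin_eq ρ (T := endToLin ρ' T') fun g => by
      obtain ⟨n, rfl⟩ := hπ g
      rw [← h, endToLin_comm]
    exact ⟨T, endToLin_injective ρ' (by rw [hφ, hT])⟩

section Section

variable {p : ℕ} {G Ω : Type*} [Group G] [MulAction G Ω] {X : Set Ω}

theorem sectionPerm_inv_mk_coe (H K : Subgroup G) [(K.subgroupOf H).Normal]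
    (hH : H ≤ setStab G X) (hK : K ≤ pointStab G X) (h : H) (x : X) :
    (((sectionPerm X H K hH hK (QuotientGroup.mk h))⁻¹ x : X) : Ω) = (h : G)⁻¹ • (x : Ω) := by
  rw [← map_inv, ← QuotientGroup.mk_inv, sectionPerm_mk]
  rfl

variable [Fact p.Prime] [Finite G]

theorem sylowSub_subgroupOf_le (hX : IsClosedSet p G X) (Q : Sylow p (pointStab G X)) :
    (sylowSub Q).subgroupOf (sylowNormalizer Q) ≤
      ((pointStab G X).subgroupOf (setStab G X)).comap
        (Subgroup.inclusion (hX.normalizer_le Q)) :=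
  fun _ hg => sylowSub_le_pointStab Q hg

/-- The homomorphism from `N_G(Q_X) / Q_X` to `M_X`. -/
def sectionMap (hX : IsClosedSet p G X) (Q : Sylow p (pointStab G X)) : NQ Q →* MX G X :=
  QuotientGroup.map _ _ (Subgroup.inclusion (hX.normalizer_le Q)) (sylowSub_subgroupOf_le hX Q)

theorem sectionPerm_sectionMap (hX : IsClosedSet p G X) (Q : Sylow p (pointStab G X)) (n : NQ Q) :
    sectionPerm X (sylowNormalizer Q) (sylowSub Q) (hX.normalizer_le Q)
      (sylowSub_le_pointStab Q) n =
    sectionPerm X (setStab G X) (pointStab G X) le_rfl le_rfl (sectionMap hX Q n) := by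
  induction n using QuotientGroup.induction_on with
  | _ n => rfl

/-- The Frattini argument. -/
theorem exists_mul_mem_normalizer (Q : Sylow p (pointStab G X)) {g : G} (hg : g ∈ setStab G X) :
    ∃ s ∈ pointStab G X, s * g ∈ sylowNormalizer Q := by
  have hQ : IsPGroup p (sylowSub Q) := Q.2.map _
  obtain ⟨P, hP⟩ := ((hQ.map (MulAut.conj g).toMonoidHom).comap_subtype
    (K := pointStab G X)).exists_le_sylow
  obtain ⟨s, hs⟩ := MulAction.exists_smul_eq (pointStab G X) P Q
  refine ⟨s, s.2, Subgroup.mem_normalizer_fintype fun q hq => ?_⟩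
  have h1 : g * q * g⁻¹ ∈ pointStab G X :=
    (pointStab_normal (G := G) X).conj_mem
      ⟨q, pointStab_le_setStab X (sylowSub_le_pointStab Q hq)⟩ (sylowSub_le_pointStab Q hq) ⟨g, hg⟩
  have h2 : (⟨g * q * g⁻¹, h1⟩ : pointStab G X) ∈ P := hP ⟨q, hq, rfl⟩
  have h3 : ((s : G) * (g * q * g⁻¹) * (s : G)⁻¹) ∈ sylowSub (s • P) := by
    rw [sylowSub_smul]
    exact ⟨g * q * g⁻¹, ⟨_, h2, rfl⟩, rfl⟩
  rw [hs] at h3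
  rw [SetLike.mem_coe, mul_inv_rev]
  simpa only [mul_assoc] using h3

theorem sectionMap_surjective (hX : IsClosedSet p G X) (Q : Sylow p (pointStab G X)) :
    Function.Surjective (sectionMap hX Q) := by
  intro m
  induction m using QuotientGroup.induction_on with
  | _ g =>
  obtain ⟨s, hs, hsg⟩ := exists_mul_mem_normalizer Q g.2
  refine ⟨QuotientGroup.mk ⟨s * g, hsg⟩, ?_⟩
  change QuotientGroup.mk _ = _
  rw [QuotientGroup.eq]
  have := (pointStab_normal (G := G) X).conj_mem ⟨s⁻¹, pointStab_le_setStab X (inv_mem hs)⟩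
    (inv_mem hs) g⁻¹
  convert this using 1
  ext
  simp

/-- The kernel has order |S_X ∩ N_G(Q_X) : Q_X|, a divisor of |S_X : Q_X|. -/
theorem not_dvd_card_ker_sectionMap (hX : IsClosedSet p G X) (Q : Sylow p (pointStab G X)) :
    ¬ p ∣ Nat.card (sectionMap hX Q).ker := by
  have hQN : sylowSub Q ≤ sylowNormalizer Q := Subgroup.le_normalizer
  have h1 : Nat.card (sectionMap hX Q).ker * Nat.card (MX G X) = Nat.card (NQ Q) := by
    rw [← Subgroup.card_mul_index (sectionMap hX Q).ker, Subgroup.index_ker,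
      MonoidHom.range_eq_top.2 (sectionMap_surjective hX Q), Subgroup.card_top]
  have h2 : Nat.card (MX G X) = (pointStab G X).relIndex (sylowNormalizer Q) := by
    let ψ : sylowNormalizer Q →* MX G X := (sectionMap hX Q).comp (QuotientGroup.mk' _)
    have hψ : ψ.ker = (pointStab G X).subgroupOf (sylowNormalizer Q) := by
      ext n
      exact QuotientGroup.eq_one_iff (Subgroup.inclusion (hX.normalizer_le Q) n)
    have hs : Function.Surjective ψ :=
      (sectionMap_surjective hX Q).comp (QuotientGroup.mk'_surjective _)
    rw [Subgroup.relIndex, ← hψ, Subgroup.index_ker, MonoidHom.range_eq_top.2 hs,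
      Subgroup.card_top]
  have h3 := Subgroup.relIndex_mul_relIndex (sylowSub Q) (pointStab G X ⊓ sylowNormalizer Q)
    (sylowNormalizer Q) (le_inf (sylowSub_le_pointStab Q) hQN) inf_le_right
  have h4 := Subgroup.relIndex_mul_relIndex (sylowSub Q) (pointStab G X ⊓ sylowNormalizer Q)
    (pointStab G X) (le_inf (sylowSub_le_pointStab Q) hQN) inf_le_left
  have h5 : Nat.card (NQ Q) = (sylowSub Q).relIndex (sylowNormalizer Q) := rfl
  rw [Subgroup.inf_relIndex_right, ← h2, ← h5, ← h1] at h3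
  have h6 := Nat.eq_of_mul_eq_mul_right Nat.card_pos h3
  rw [← h6]
  exact fun h => not_dvd_relIndex_sylow Q (h4 ▸ h.mul_right _)

end Section

/-! ### Restricting matrices to X and extending them from X -/

section Compress

variable {k G Ω : Type*} [Field k] [Group G] [MulAction G Ω] {X : Set Ω}

theorem isInvMat_compress (X : Set Ω) {a : Matrix Ω Ω k}
    (ha : IsInvMat (MulAction.toPermHom G Ω) ⊤ a) :
    IsInvMat (sectionPerm X (setStab G X) (pointStab G X) le_rfl le_rfl) ⊤ (compress X a) := by
  intro m _
  induction m using QuotientGroup.induction_on with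
  | _ g =>
  ext x y
  change a _ _ = a _ _
  rw [sectionPerm_inv_mk_coe, sectionPerm_inv_mk_coe]
  exact isInvMat_apply ha (s := (g : G)⁻¹) trivial x y

/-- Every matrix on a subset `X` extends to a matrix that is invariant under the pointwise
stabilizer of `X`. -/
theorem exists_compress_eq (b : Matrix X X k) : ∃ a : Matrix Ω Ω k,
    IsInvMat (MulAction.toPermHom G Ω) (pointStab G X) a ∧ compress X a = b := by
  classical
  let F : Ω → Ω → k := fun x y => if h : x ∈ X ∧ y ∈ X then b ⟨x, h.1⟩ ⟨y, h.2⟩ else 0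
  refine ⟨Matrix.of F, fun s hs => ?_, ?_⟩
  · have hX : ∀ x ∈ X, s⁻¹ • x = x := fun x hx =>
      (mem_fixingSubgroup_iff G).1 (inv_mem hs) x hx
    have hX' : ∀ x, s⁻¹ • x ∈ X ↔ x ∈ X := fun x =>
      MulAction.mem_stabilizer_set.1 (inv_mem (pointStab_le_setStab X hs)) x
    ext x y
    change F (s⁻¹ • x) (s⁻¹ • y) = F x y
    by_cases h : x ∈ X ∧ y ∈ X
    · rw [hX x h.1, hX y h.2]
    · have h' : ¬ (s⁻¹ • x ∈ X ∧ s⁻¹ • y ∈ X) := by rwa [hX', hX']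
      simp only [F, dif_neg h', dif_neg h]
  · ext x y
    exact dif_pos ⟨x.2, y.2⟩

end Compress

/-! ### The Brauer homomorphism and its effect on traces from Q_X -/

section BrauerTrace

variable {p : ℕ} [Fact p.Prime] {k G Ω : Type*} [Field k] [CharP k p] [Group G] [Finite G]
  [MulAction G Ω] {X : Set Ω}

/-- The cosets of Q_X fixed by Q_X are exactly those represented in N_G(Q_X), and only they
contribute to entries in X. -/
theorem compress_relTrace (hX : IsClosedSet p G X) (Q : Sylow p (pointStab G X))
    [Fintype (G ⧸ sylowSub Q)] [Fintype (NQ Q)] {a : Matrix Ω Ω k}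
    (ha : IsInvMat (MulAction.toPermHom G Ω) (sylowSub Q) a) :
    compress X (relTrace (MulAction.toPermHom G Ω) (sylowSub Q) a) =
      ∑ n : NQ Q, permConj (sectionPerm X (sylowNormalizer Q) (sylowSub Q) (hX.normalizer_le Q)
        (sylowSub_le_pointStab Q) n) (compress X a) := by
  classical
  have hF : ∀ x y : Ω, ∀ g, ∀ r ∈ sylowSub Q,
      a ((g * r)⁻¹ • x) ((g * r)⁻¹ • y) = a (g⁻¹ • x) (g⁻¹ • y) := by
    intro x y g r hr
    simpa [mul_smul] using isInvMat_apply ha (inv_mem hr) (g⁻¹ • x) (g⁻¹ • y)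
  have hfix := hX.fixedPoints_eq Q
  ext x y
  change relTrace _ _ a x y = _
  rw [relTrace_apply_fixedPoints (Q.2.map _) ha (hfix.ge x.2) (hfix.ge y.2), Matrix.sum_apply]
  symm
  refine Finset.sum_nbij (fun n => ((n.out : G) : G ⧸ sylowSub Q)) (fun n _ => ?_)
    (fun n _ n' _ h => ?_) (fun t ht => ?_) (fun n _ => ?_)
  · rw [Finset.mem_filter]
    refine ⟨Finset.mem_univ _, fun q => ?_⟩
    change (((q : G) * n.out : G) : G ⧸ sylowSub Q) = _
    rw [eq_comm, QuotientGroup.eq, ← mul_assoc]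
    have := (Subgroup.mem_normalizer_iff.1 (inv_mem n.out.2) q).1 q.2
    simpa using this
  · rw [← QuotientGroup.out_eq' n, ← QuotientGroup.out_eq' n', QuotientGroup.eq]
    have h' : ((n.out : G) : G ⧸ sylowSub Q) = ((n'.out : G) : G ⧸ sylowSub Q) := h
    have h'' := QuotientGroup.eq.1 h'
    exact h''
  · have ht' := (Finset.mem_filter.1 ht).2
    have hN : t.out⁻¹ ∈ sylowNormalizer Q := by
      apply Subgroup.mem_normalizer_fintype
      intro q hq
      rw [inv_inv]
      exact conj_mem_of_mem_fixedPoints ht' hq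
    refine ⟨QuotientGroup.mk (⟨t.out, by simpa using inv_mem hN⟩ : sylowNormalizer Q),
      Finset.mem_coe.2 (Finset.mem_univ _), ?_⟩
    conv_rhs => rw [← QuotientGroup.out_eq' t]
    have h := QuotientGroup.eq.1 (QuotientGroup.out_eq'
      (QuotientGroup.mk (⟨t.out, by simpa using inv_mem hN⟩ : sylowNormalizer Q) : NQ Q))
    exact QuotientGroup.eq.2 h
  · rw [apply_out_mk (F := fun g => a (g⁻¹ • (x : Ω)) (g⁻¹ • (y : Ω))) (hF x y), permConj_apply]
    conv_lhs => rw [← QuotientGroup.out_eq' n]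
    change a _ _ = _
    rw [sectionPerm_inv_mk_coe, sectionPerm_inv_mk_coe]

variable [Fintype Ω] [DecidableEq Ω] [Fintype X] [DecidableEq X]

theorem exists_brauerHom (hX : IsClosedSet p G X) :
    ∃ φ : Module.End k[G] (Representation.ofMulAction k G Ω).asModule →ₐ[k]
        Module.End k[MX G X] (repMX k G X).asModule,
      ∀ T, endMat _ (φ T) = compress X (endMat _ T) := by
  obtain ⟨Q, hQ⟩ := hX
  have hinv := fun T : Module.End k[G] (Representation.ofMulAction k G Ω).asModule =>
    isInvMat_endMat ofMulAction_eq_toPermHom T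
  let g : Module.End k[G] (Representation.ofMulAction k G Ω).asModule →ₐ[k] Matrix X X k :=
    { toFun := fun T => compress X (endMat _ T)
      map_one' := by
        rw [map_one]
        exact Matrix.submatrix_one _ Subtype.val_injective
      map_mul' := fun S T => by
        rw [map_mul]
        exact compress_mul (p := p) (Q.2.map _) hQ (hinv S _) (hinv T _)
      map_zero' := by
        rw [map_zero]
        rfl
      map_add' := fun S T => by
        rw [map_add]
        rfl
      commutes' := fun c => by
        rw [AlgHom.commutes, Algebra.algebraMap_eq_smul_one, Algebra.algebraMap_eq_smul_one]
        change c • (1 : Matrix Ω Ω k).submatrix _ _ = _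
        rw [Matrix.submatrix_one _ Subtype.val_injective] }
  exact exists_algHom_of_injective endMat_injective g fun T =>
    exists_endMat_eq (f := sectionPerm X (setStab G X) (pointStab G X) le_rfl le_rfl)
      (fun _ => rfl) (isInvMat_compress X (hinv T ⊤))

end BrauerTrace

/-! ### The two correspondences -/

section Correspondence

variable {p : ℕ} [Fact p.Prime] {k G Ω : Type*} [Field k] [CharP k p] [Group G] [Finite G]
  [MulAction G Ω] {X : Set Ω}

instance finiteDimensional_asModule {Γ Y : Type*} [Group Γ] [Finite Y]
    (ρ : Representation k Γ k[Y]) : FiniteDimensional k ρ.asModule :=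
  Module.Finite.equiv ((MonoidAlgebra.coeffLinearEquiv k).symm.trans ρ.asModuleEquiv.symm)

theorem card_ker_sectionMap_ne_zero (hX : IsClosedSet p G X) (Q : Sylow p (pointStab G X)) :
    (Nat.card (sectionMap hX Q).ker : k) ≠ 0 := by
  rw [Ne, CharP.cast_eq_zero_iff k p]
  exact not_dvd_card_ker_sectionMap hX Q

/-- The sum over N_G(Q_X)/Q_X depends only on images in M_X, and each image is hit as often as the
kernel has elements, a number invertible in k. -/
theorem compress_relTrace_eq_sum (hX : IsClosedSet p G X) (Q : Sylow p (pointStab G X))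
    [Fintype (G ⧸ sylowSub Q)] [Fintype (MX G X)] {a : Matrix Ω Ω k}
    (ha : IsInvMat (MulAction.toPermHom G Ω) (sylowSub Q) a) :
    compress X (relTrace (MulAction.toPermHom G Ω) (sylowSub Q) a) =
      ∑ m : MX G X, permConj (sectionPerm X (setStab G X) (pointStab G X) le_rfl le_rfl m)
        ((Nat.card (sectionMap hX Q).ker : k) • compress X a) := by
  have := Fintype.ofFinite (NQ Q)
  rw [compress_relTrace hX Q ha]
  simp only [sectionPerm_sectionMap hX Q]
  rw [sum_comp_surjective (sectionMap hX Q) (sectionMap_surjective hX Q)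
    fun m => permConj (sectionPerm X (setStab G X) (pointStab G X) le_rfl le_rfl m) (compress X a)]
  simp only [permConj_smul]
  rw [← Finset.smul_sum, Nat.cast_smul_eq_nsmul]

theorem exists_fixedPoint_correspondence [Finite Ω] (hX : IsClosedSet p G X) :
    ∃ Φ : ComponentType k[G] (Representation.ofMulAction k G Ω).asModule
          (AdmitsFixedPointSet k G X) ≃ ProjComponentType (repMX k G X),
      MultiplicityPreserving Φ := by
  classical
  have := Fintype.ofFinite Ω
  have := Fintype.ofFinite X
  have := Fintype.ofFinite (MX G X)
  obtain ⟨φ, hφ⟩ := exists_brauerHom (k := k) hX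
  let Q : Sylow p (pointStab G X) := default
  have := Fintype.ofFinite (G ⧸ sylowSub Q)
  have hρ := fun g => ofMulAction_eq_toPermHom (k := k) (G := G) (Ω := Ω) g
  let f₁ := sectionPerm X (setStab G X) (pointStab G X) le_rfl le_rfl
  let J : Set (Module.End k[G] (Representation.ofMulAction k G Ω).asModule) :=
    {T | IsTrace (MulAction.toPermHom G Ω) (sylowSub Q) (endMat _ T)}
  have hfwd : ∀ T ∈ J, ∃ a, endMat _ (φ T) = ∑ m, permConj (f₁ m) a := by
    rintro T ⟨hfin, a, ha, hT⟩
    rw [hφ, hT, Subsingleton.elim hfin ‹_›, compress_relTrace_eq_sum hX Q ha]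
    exact ⟨_, rfl⟩
  have hbwd : ∀ T', (∃ a, endMat _ T' = ∑ m, permConj (f₁ m) a) → ∃ T ∈ J, φ T = T' := by
    rintro T' ⟨a, ha⟩
    -- The factor cancels the kernel order that appears on restricting the trace. Extension by zero
    -- is invariant under S_X, so its trace from Q_X is defined.
    obtain ⟨b, hb, hba⟩ := exists_compress_eq (G := G)
      ((Nat.card (sectionMap hX Q).ker : k)⁻¹ • a)
    have hb' := hb.mono (sylowSub_le_pointStab Q)
    obtain ⟨T, hT⟩ := exists_endMat_eq hρ (isInvMat_relTrace hb')
    refine ⟨T, ⟨_, b, hb', hT⟩, endMat_injective ?_⟩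
    rw [hφ, hT, compress_relTrace_eq_sum hX Q hb', hba, smul_smul,
      mul_inv_cancel₀ (card_ker_sectionMap_ne_zero hX Q), one_smul, ha]
  have hinv := fun c : Module.End k[MX G X] (repMX k G X).asModule =>
    isInvMat_endMat (f := f₁) (fun _ => rfl) c ⊤
  have hJ : IsLiftable (k := k) (E' := Module.End k[MX G X] (repMX k G X).asModule) φ J := by
    refine ⟨fun c j hj => ?_, fun j hj c => ?_, fun c j hj => ?_, fun j hj c => ?_⟩
    · change IsTrace _ _ _
      rw [map_mul]
      exact hj.mul_left (isInvMat_endMat hρ c ⊤)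
    · change IsTrace _ _ _
      rw [map_mul]
      exact hj.mul_right (isInvMat_endMat hρ c ⊤)
    · obtain ⟨a, ha⟩ := hfwd j hj
      exact hbwd (c * φ j) ⟨_, by rw [map_mul, ha, mul_sum_permConj (hinv c)]⟩
    · obtain ⟨a, ha⟩ := hfwd j hj
      exact hbwd (φ j * c) ⟨_, by rw [map_mul, ha, sum_permConj_mul (hinv c)]⟩
  refine hJ.exists_multiplicityPreserving k (fun e he => ?_) (fun e he => ?_)
  · rw [admitsFixedPointSet_range_iff hX Q he, ← hφ, Ne, map_eq_zero_iff _ endMat_injective]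
    rfl
  · rw [projective_range_iff_endMat (f := f₁) (fun _ => rfl) he.idem]
    refine ⟨hbwd e, ?_⟩
    rintro ⟨j, hj, rfl⟩
    exact hfwd j hj

theorem exists_normalizer_correspondence [Finite Ω] (hX : IsClosedSet p G X)
    (Q : Sylow p (pointStab G X)) :
    ∃ (e : ProjComponent (repMX k G X) ≃ ProjComponent (repNQ k hX Q))
      (Φ : ProjComponentType (repMX k G X) ≃ ProjComponentType (repNQ k hX Q)),
      (∀ U, (repNQ k hX Q).asModuleEquiv '' ((e U).1 : Set _) =
        (repMX k G X).asModuleEquiv '' (U.1 : Set _)) ∧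
      (∀ U, Φ (Quotient.mk _ U) = Quotient.mk _ (e U)) ∧
      MultiplicityPreserving Φ := by
  have := Fintype.ofFinite (MX G X)
  have := Fintype.ofFinite (NQ Q)
  have hρ : ∀ n, repNQ k hX Q n = repMX k G X (sectionMap hX Q n) := fun n =>
    congrArg (Representation.ofMulAction k (Equiv.Perm X) X) (sectionPerm_sectionMap hX Q n)
  obtain ⟨φ, hφ⟩ := exists_algEquiv_of_surjective (sectionMap_surjective hX Q) hρ
  let σ := (repMX k G X).asModuleEquiv.toEquiv.trans (repNQ k hX Q).asModuleEquiv.symm.toEquiv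
  -- Traces from 1 for the two groups differ by the invertible kernel order, so both groups have the
  -- same trace ideal and the same projective components.
  have hsum : ∀ θ : Module.End k k[X], ∑ n, repNQ k hX Q n * θ * repNQ k hX Q n⁻¹ =
      ∑ m, repMX k G X m * ((Nat.card (sectionMap hX Q).ker : k) • θ) * repMX k G X m⁻¹ := by
    intro θ
    simp only [hρ, map_inv]
    rw [sum_comp_surjective (sectionMap hX Q) (sectionMap_surjective hX Q)
      fun m => repMX k G X m * θ * repMX k G X m⁻¹, ← Nat.cast_smul_eq_nsmul k, Finset.smul_sum]
    simp only [mul_smul_comm, smul_mul_assoc]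
  obtain ⟨F, Φ, hF, hΦ, hm⟩ := exists_equiv_of_algEquiv k
    (P := fun W => Module.Projective k[MX G X] W) (R := fun W => Module.Projective k[NQ Q] W)
    φ σ (fun T v => LinearMap.congr_fun (hφ T) v) (fun e he => by
      have he' : φ e * φ e = φ e := by rw [← map_mul, he.idem]
      rw [projective_range_iff _ he.idem, projective_range_iff _ he', hφ]
      simp only [hsum]
      constructor
      · rintro ⟨θ, hθ⟩
        refine ⟨(Nat.card (sectionMap hX Q).ker : k)⁻¹ • θ, ?_⟩
        rw [smul_smul, mul_inv_cancel₀ (card_ker_sectionMap_ne_zero hX Q), one_smul, hθ]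
      · rintro ⟨θ, hθ⟩
        exact ⟨_, hθ⟩)
  refine ⟨F, Φ, fun U => ?_, hΦ, hm⟩
  rw [hF, Set.image_image]
  rfl

end Correspondence

end PermMod

theorem theorem2p11 {p : ℕ} [Fact p.Prime] (k : Type*) [Field k] [CharP k p]
    {G : Type*} [Group G] [Finite G] {Ω : Type*} [Finite Ω] [MulAction G Ω]
    (X : Set Ω) (hX : PermMod.IsClosedSet p G X) :
    (∀ Q : Sylow p (PermMod.pointStab G X),
      ∃ (e : PermMod.ProjComponent (PermMod.repMX k G X) ≃
            PermMod.ProjComponent (PermMod.repNQ k hX Q))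
        (Φ : PermMod.ProjComponentType (PermMod.repMX k G X) ≃
            PermMod.ProjComponentType (PermMod.repNQ k hX Q)),
        (∀ U, (PermMod.repNQ k hX Q).asModuleEquiv '' ((e U).1 : Set _) =
          (PermMod.repMX k G X).asModuleEquiv '' (U.1 : Set _)) ∧
        (∀ U, Φ (Quotient.mk _ U) = Quotient.mk _ (e U)) ∧
        PermMod.MultiplicityPreserving Φ) ∧
    (∃ Φ : PermMod.ComponentType k[G] (Representation.ofMulAction k G Ω).asModule
          (PermMod.AdmitsFixedPointSet k G X) ≃
        PermMod.ProjComponentType (PermMod.repMX k G X),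
      PermMod.MultiplicityPreserving Φ) ∧
    (PermMod.IsFixedPointSet k G X ↔ Nonempty (PermMod.ProjComponent (PermMod.repMX k G X))) := by
  have hcorr := PermMod.exists_fixedPoint_correspondence (k := k) hX
  refine ⟨PermMod.exists_normalizer_correspondence hX, hcorr, ?_⟩
  -- The last claim only uses that one set of isomorphism types is nonempty exactly when the other
  -- is.
  obtain ⟨Φ, -⟩ := hcorr
  constructor
  · rintro ⟨W, hW⟩
    obtain ⟨U, -⟩ := Quotient.exists_rep (Φ (Quotient.mk _ ⟨W, hW⟩))
    exact ⟨U⟩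
  · rintro ⟨U⟩
    obtain ⟨W, -⟩ := Quotient.exists_rep (Φ.symm (Quotient.mk _ U))
    exact ⟨W.1, W.2⟩
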